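/- Let $S$ be a Banach space (over $\mathbb R$ or $\mathbb C$) with a Schauder basis $(e_j)_{j\ge1}$ and coordinate functionals $(e_j^*)_{j\ge1}\subset S^*$, where $\|e_j\|=\|e_j^*\|=1$ for all $j$; then $(e_j^*)$ is called a weak$^*$ Schauder basis of $S^*$, and $x^*=\sum_j\langle x^*,e_j\rangle e_j^*$ for all $x^*\in S^*$. All series in $S^*$ converge in the weak$^*$ topology. Assume that $(e_j^*)$ is subsymmetric, i.e. (a) $(e_j^*)$ is unconditional: there is $C\ge1$ such that $\bigl\|\sum_j\gamma_ja_je_j^*\bigr\|\le C\sup_j|\gamma_j|\,\bigl\|\sum_ja_je_j^*\bigr\|$ for all scalars $(a_j)$ for which $\sum_ja_je_j^*$ converges in $S^*$ and all $(\gamma_j)\in\ell^\infty$; let $K_u$ be the infimum of all such $C\ge 1$; (b) for every strictly increasing sequence $(n_j)$ in $\mathbb N$, the map $S_{(n_j)}:\sum_ja_je_j^*\mapsto\sum_ja_je_{n_j}^*$ is an isomorphism from $S^*$ onto the weak$^*$ closure of $\operatorname{span}\{e_{n_j}^*\}_{j}$; let $K_s=\sup_{(n_j)}\max\{\|S_{(n_j)}\|,\|S_{(n_j)}^{-1}\|\}$.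 For $\mathcal A\subset\mathbb N$ put $P_{\mathcal A}\bigl(\sum_ja_je_j^*\bigr)=\sum_{j\in\mathcal A}a_je_j^*$. Assume moreover that $S^*$ with $(e_j^*)$ satisfies condition (C): for every infinite $\Lambda\subset\mathbb N$ and every $\theta>0$ there is a sequence $(\mathcal A_j)$ of pairwise disjoint infinite subsets of $\Lambda$ such that for all $(x_j^*)\subset S^*$ with $\|x_j^*\|\le1$ there is $(a_j)\in\ell^1$ with $\|(a_j)\|_{\ell^1}=1$ and $\bigl\|\sum_ja_jP_{\mathcal A_j}x_j^*\bigr\|\le\theta$. Let $1\le p\le\infty$, and let $\ell^p(S^*)$ be the Banach space of sequences $(y_n)$ in $S^*$ with $\|(y_n)\|=\bigl(\sum_n\|y_n\|^p\bigr)^{1/p}<\infty$ (the supremum of the norms if $p=\infty$). Then for every bounded linear operator $T$ on $\ell^p(S^*)$ there are $H\in\{T,\ \mathrm{Id}-T\}$ and bounded linear operators $M,N$ on $\ell^p(S^*)$ with $$NHM=\mathrm{Id}_{\ell^p(S^*)}\qquad\text{and}\qquad\|M\|\,\|N\|\le48\,K_u^7K_s^4 .$$ Moreover, $\ell^p(S^*)$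 is primary: for every bounded projection $Q$ on $\ell^p(S^*)$, the range of $Q$ or the range of $\mathrm{Id}-Q$ is isomorphic to $\ell^p(S^*)$. -/

import Mathlib

open scoped ENNReal
open Filter Topology

noncomputable section

/-- The series `∑ f j` in the dual of `X` converges to `y` in the weak* topology, i.e. its partial
sums converge to `y` pointwise on `X`. -/
def HasWeakStarSum {𝕜 X : Type*} [RCLike 𝕜] [NormedAddCommGroup X] [NormedSpace 𝕜 X]
    (f : ℕ → StrongDual 𝕜 X) (y : StrongDual 𝕜 X) : Prop :=
  ∀ x : X, Tendsto (fun n : ℕ => ∑ j ∈ Finset.range n, f j x) atTop (𝓝 (y x))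

theorem HasWeakStarSum.unique {𝕜 X : Type*} [RCLike 𝕜] [NormedAddCommGroup X] [NormedSpace 𝕜 X]
    {f : ℕ → StrongDual 𝕜 X} {y z : StrongDual 𝕜 X}
    (hy : HasWeakStarSum f y) (hz : HasWeakStarSum f z) : y = z := by
  ext x
  exact tendsto_nhds_unique (hy x) (hz x)

open Classical in
/-- The weak* sum of the series `∑ f j` (and `0` if the series does not converge weak*). -/
def weakStarSum {𝕜 X : Type*} [RCLike 𝕜] [NormedAddCommGroup X] [NormedSpace 𝕜 X]
    (f : ℕ → StrongDual 𝕜 X) : StrongDual 𝕜 X :=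
  if h : ∃ y, HasWeakStarSum f y then h.choose else 0

theorem HasWeakStarSum.weakStarSum_eq {𝕜 X : Type*} [RCLike 𝕜] [NormedAddCommGroup X]
    [NormedSpace 𝕜 X] {f : ℕ → StrongDual 𝕜 X} {y : StrongDual 𝕜 X}
    (hy : HasWeakStarSum f y) : weakStarSum f = y := by
  have h : ∃ y, HasWeakStarSum f y := ⟨y, hy⟩
  rw [weakStarSum, dif_pos h]
  exact h.choose_spec.unique hy

/-- The set consisting of the norm of an isomorphism `Φ` from `E` onto a subspace `Y` and the norm
of its inverse. -/
def isoNorms {𝕜 E : Type*} [RCLike 𝕜] [NormedAddCommGroup E] [NormedSpace 𝕜 E]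
    {Y : Submodule 𝕜 E} (Φ : E ≃L[𝕜] Y) : Set ℝ :=
  {‖(Φ : E →L[𝕜] Y)‖, ‖(Φ.symm : Y →L[𝕜] E)‖}

namespace WeakStarBasis

/-! Throughout, `b` is a Schauder basis `(e j)` of `X`; the sequence `b.coord` of its coordinate
functionals is the corresponding weak* Schauder basis `(e* j)` of the dual of `X`. -/

section

variable {𝕜 X : Type*} [RCLike 𝕜] [NormedAddCommGroup X] [NormedSpace 𝕜 X]

/-- The basis and its coordinate functionals are normalized. -/
def IsNormalized (b : SchauderBasis 𝕜 X) : Prop :=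
  (∀ j, ‖b j‖ = 1) ∧ ∀ j, ‖b.coord j‖ = 1

/-- The constants `C ≥ 1` with `‖∑ γ j a j e* j‖ ≤ C (sup |γ j|) ‖∑ a j e* j‖` whenever the series
`∑ a j e* j` converges weak* and `γ` is a bounded sequence of scalars (the convergence of
`∑ γ j a j e* j` being part of the requirement). -/
def unconditionalConstants (b : SchauderBasis 𝕜 X) : Set ℝ :=
  {C | 1 ≤ C ∧ ∀ (a : ℕ → 𝕜) (y : StrongDual 𝕜 X), HasWeakStarSum (fun j => a j • b.coord j) y →
    ∀ γ : lp (fun _ : ℕ => 𝕜) ∞, ∃ z : StrongDual 𝕜 X,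
      HasWeakStarSum (fun j => (γ j * a j) • b.coord j) z ∧ ‖z‖ ≤ C * ‖γ‖ * ‖y‖}

/-- The weak* Schauder basis `(e* j)` is unconditional. -/
def IsUnconditional (b : SchauderBasis 𝕜 X) : Prop :=
  (unconditionalConstants b).Nonempty

/-- The unconditionality constant `K_u`. -/
def Ku (b : SchauderBasis 𝕜 X) : ℝ := sInf (unconditionalConstants b)

/-- The weak* closure of the linear span of `{e* (n j) : j ∈ ℕ}`, as a subspace of the dual. -/
def weakStarSpan (b : SchauderBasis 𝕜 X) (n : ℕ → ℕ) : Submodule 𝕜 (StrongDual 𝕜 X) :=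
  (Submodule.span 𝕜 (Set.range fun j =>
      StrongDual.toWeakDual (b.coord (n j)))).topologicalClosure.comap
    (StrongDual.toWeakDual (𝕜 := 𝕜) (E := X)).toLinearMap

/-- `Φ` is the operator `∑ a j e* j ↦ ∑ a j e* (n j)` from the dual of `X` to the weak* closed span
of the `e* (n j)`. -/
def IsSubsequenceMap (b : SchauderBasis 𝕜 X) (n : ℕ → ℕ)
    (Φ : StrongDual 𝕜 X →L[𝕜] weakStarSpan b n) : Prop :=
  ∀ (a : ℕ → 𝕜) (y : StrongDual 𝕜 X), HasWeakStarSum (fun j => a j • b.coord j) y →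
    HasWeakStarSum (fun j => a j • b.coord (n j)) (Φ y : StrongDual 𝕜 X)

/-- The weak* Schauder basis `(e* j)` is subsymmetric: it is unconditional, and for every increasing
sequence `n` the map `∑ a j e* j ↦ ∑ a j e* (n j)` is an isomorphism from the dual of `X` onto the
weak* closed span of the `e* (n j)`. -/
def IsSubsymmetric (b : SchauderBasis 𝕜 X) : Prop :=
  IsUnconditional b ∧ ∀ n : ℕ → ℕ, StrictMono n →
    ∃ Φ : StrongDual 𝕜 X ≃L[𝕜] weakStarSpan b n, IsSubsequenceMap b n Φ

/-- The subsymmetry constant `K_s`: the supremum of the norms of the above isomorphisms and of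
their inverses. -/
def Ks (b : SchauderBasis 𝕜 X) : ℝ :=
  sSup {r | ∃ n : ℕ → ℕ, StrictMono n ∧ ∃ Φ : StrongDual 𝕜 X ≃L[𝕜] weakStarSpan b n,
    IsSubsequenceMap b n Φ ∧ r ∈ isoNorms Φ}

open Classical in
/-- The projection `P_A (∑ a j e* j) = ∑_{j ∈ A} a j e* j`, where `a j` is the value of the
functional at `e j`. -/
def coordProj (b : SchauderBasis 𝕜 X) (A : Set ℕ) (y : StrongDual 𝕜 X) : StrongDual 𝕜 X :=
  weakStarSum fun j => if j ∈ A then y (b j) • b.coord j else 0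

/-- Condition (C): for every infinite `Λ ⊆ ℕ` and `θ > 0` there are pairwise disjoint infinite
sets `A j ⊆ Λ` such that for all `x* j` in the unit ball of the dual there is a norm one sequence
`a` in `ℓ¹` for which `∑ a j P_{A j} (x* j)` (a weak* convergent series) has norm at most `θ`. -/
def ConditionC (b : SchauderBasis 𝕜 X) : Prop :=
  ∀ Λ : Set ℕ, Λ.Infinite → ∀ θ : ℝ, 0 < θ →
    ∃ A : ℕ → Set ℕ, (∀ j, A j ⊆ Λ ∧ (A j).Infinite) ∧ Pairwise (fun i j => Disjoint (A i) (A j)) ∧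
      ∀ x : ℕ → StrongDual 𝕜 X, (∀ j, ‖x j‖ ≤ 1) →
        ∃ a : lp (fun _ : ℕ => 𝕜) 1, ‖a‖ = 1 ∧ ∃ z : StrongDual 𝕜 X,
          HasWeakStarSum (fun j => a j • coordProj b (A j) (x j)) z ∧ ‖z‖ ≤ θ

end

end WeakStarBasis

/-- A normed space `E` is primary if for every bounded projection `Q` on `E` the range of `Q` or
the range of `id - Q` is isomorphic to `E`. -/
def IsPrimary (𝕜 E : Type*) [RCLike 𝕜] [NormedAddCommGroup E] [NormedSpace 𝕜 E] : Prop :=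
  ∀ Q : E →L[𝕜] E, Q ∘L Q = Q →
    Nonempty (Q.range ≃L[𝕜] E) ∨ Nonempty ((ContinuousLinearMap.id 𝕜 E - Q).range ≃L[𝕜] E)

end

/-! The factorization comes from making a matrix almost diagonal. Write `E` for the dual of `S`, and
index the coordinates of `ℓᵖ(E)` by pairs (row, place). The diagonals of `T` and `Id - T` add up to
1, so at each pair one of them has modulus at least 1/2. By pigeonhole, for `H = T` or `H = Id - T`
the set of pairs with diagonal entry at least 1/2 has infinitely many infinite rows. Inside this set
one picks pairs `γ k` and shrinking sets `Q k`, with `γ l ∈ Q k` exactly for `k < l`. Both the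
column of `H` at `γ k` and the row functional at `γ k` are tiny on `Q k` (`exists_almost_diagonal`).
The selected pairs again form infinitely many infinite rows, so by subsymmetry they carry a
complemented copy of `ℓᵖ(E)`. Compressing `H` to that copy and dividing by the diagonal gives an
operator within 1/2 of the identity, which a Neumann series inverts.

Condition (C) supplies the smallness. A functional that stayed large on all infinite subsets would,
after an unconditional change of phases, be large on a combination of small norm
(`exists_norm_comp_proj_le`). The same argument shows that the system is weakly null, uniformly over
subsequences (`exists_norm_apply_vec_le`). Together with the alternative "the all-ones sequence is
in `E`, or all coordinate sequences are null", this makes columns small on infinite subsets. The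
uniform `N` is what permits treating infinitely many rows at once when `p = ∞`.

Two further ingredients are independent of this. Primarity follows from the factorization by
Pełczyński's decomposition method. Finiteness of `K_s`, needed because it is a real supremum, is a
gliding hump argument (`exists_uniform_bound`). -/

/-! ### Row operators on `ℓᵖ` sums. -/

section LpOperators

variable {𝕜 E F : Type*} [RCLike 𝕜] [NormedAddCommGroup E] [NormedSpace 𝕜 E]
  [NormedAddCommGroup F] [NormedSpace 𝕜 F] {ι κ : Type*} {p : ℝ≥0∞} [Fact (1 ≤ p)]

theorem lp_exponent_ne_zero (p : ℝ≥0∞) [h : Fact (1 ≤ p)] : p ≠ 0 :=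
  (zero_lt_one.trans_le h.out).ne'

theorem lp_exponent_toReal_pos {p : ℝ≥0∞} [Fact (1 ≤ p)] (hp : p ≠ ∞) : 0 < p.toReal :=
  ENNReal.toReal_pos (lp_exponent_ne_zero p) hp

/-- Each input entry is charged to at most one output entry, by injectivity of `σ` on `s`, so the
`ℓᵖ` norm grows by at most the factor `C`. -/
theorem lp_exists_dominated {σ : κ → ι} {s : Set κ} (hσ : Set.InjOn σ s)
    (y : lp (fun _ : ι => E) p) {w : κ → F} {C : ℝ} (hC : 0 ≤ C) (h0 : ∀ k ∉ s, w k = 0)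
    (hw : ∀ k ∈ s, ‖w k‖ ≤ C * ‖y (σ k)‖) :
    ∃ x : lp (fun _ : κ => F) p, (∀ k, x k = w k) ∧ ‖x‖ ≤ C * ‖y‖ := by
  classical
  have hp0 := lp_exponent_ne_zero p
  rcases eq_or_ne p ∞ with rfl | hp
  · have hb : ∀ k, ‖w k‖ ≤ C * ‖y‖ := fun k => by
      by_cases hk : k ∈ s
      · exact (hw k hk).trans (mul_le_mul_of_nonneg_left (lp.norm_apply_le_norm hp0 y _) hC)
      · rw [h0 k hk, norm_zero]; positivity
    refine ⟨⟨w, memℓp_infty ⟨C * ‖y‖, ?_⟩⟩, fun _ => rfl, ?_⟩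
    · rintro _ ⟨k, rfl⟩; exact hb k
    · exact lp.norm_le_of_forall_le (by positivity) hb
  · have hr := lp_exponent_toReal_pos hp
    have hb : ∀ t : Finset κ, ∑ k ∈ t, ‖w k‖ ^ p.toReal ≤ (C * ‖y‖) ^ p.toReal := fun t => by
      calc ∑ k ∈ t, ‖w k‖ ^ p.toReal
          = ∑ k ∈ t with k ∈ s, ‖w k‖ ^ p.toReal := by
            rw [Finset.sum_filter]
            refine Finset.sum_congr rfl fun k _ => ?_
            split_ifs with hk
            · rfl
            · rw [h0 k hk, norm_zero, Real.zero_rpow hr.ne']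
        _ ≤ ∑ k ∈ t with k ∈ s, C ^ p.toReal * ‖y (σ k)‖ ^ p.toReal := by
            refine Finset.sum_le_sum fun k hk => ?_
            rw [← Real.mul_rpow hC (norm_nonneg _)]
            exact Real.rpow_le_rpow (norm_nonneg _) (hw k (Finset.mem_filter.1 hk).2) hr.le
        _ = C ^ p.toReal * ∑ i ∈ (t.filter (· ∈ s)).image σ, ‖y i‖ ^ p.toReal := by
            rw [← Finset.mul_sum, Finset.sum_image]
            intro a ha b hb hab
            exact hσ (Finset.mem_filter.1 ha).2 (Finset.mem_filter.1 hb).2 hab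
        _ ≤ C ^ p.toReal * ‖y‖ ^ p.toReal :=
            mul_le_mul_of_nonneg_left (lp.sum_rpow_le_norm_rpow hr y _) (by positivity)
        _ = (C * ‖y‖) ^ p.toReal := (Real.mul_rpow hC (norm_nonneg _)).symm
    exact ⟨⟨w, memℓp_gen' hb⟩, fun _ => rfl,
      lp.norm_le_of_forall_sum_le hr (by positivity) hb⟩

theorem lp_exists_op (p : ℝ≥0∞) [Fact (1 ≤ p)] (σ : κ → ι) (A : κ → E →L[𝕜] F)
    (hσ : Set.InjOn σ {k | A k ≠ 0}) {C : ℝ} (hC : 0 ≤ C) (hA : ∀ k, ‖A k‖ ≤ C) :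
    ∃ B : lp (fun _ : ι => E) p →L[𝕜] lp (fun _ : κ => F) p,
      ‖B‖ ≤ C ∧ ∀ y k, B y k = A k (y (σ k)) := by
  have key : ∀ y : lp (fun _ : ι => E) p, ∃ x : lp (fun _ : κ => F) p,
      (∀ k, x k = A k (y (σ k))) ∧ ‖x‖ ≤ C * ‖y‖ := fun y =>
    lp_exists_dominated hσ y hC (fun k hk => by
        have : A k = 0 := by simpa using hk
        simp [this])
      (fun k _ => (A k).le_of_opNorm_le (hA k) _)
  choose B hB hBn using key
  refine ⟨LinearMap.mkContinuous
    { toFun := B, map_add' := fun x y => ?_, map_smul' := fun c x => ?_ } C hBn,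
    LinearMap.mkContinuous_norm_le _ hC _, fun y k => hB y k⟩
  · ext k; simp [hB]
  · ext k; simp [hB]

/-- The spaces `ℓᵖ(ι × κ, E)` and `ℓᵖ(ι, ℓᵖ(κ, E))` are isomorphic. -/
theorem lp_nonempty_curry (𝕜 E : Type*) [RCLike 𝕜] [NormedAddCommGroup E] [NormedSpace 𝕜 E]
    (ι κ : Type*) (p : ℝ≥0∞) [Fact (1 ≤ p)] :
    Nonempty (lp (fun _ : ι × κ => E) p ≃L[𝕜] lp (fun _ : ι => lp (fun _ : κ => E) p) p) := by
  classical
  have hp0 := lp_exponent_ne_zero p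
  have hrow : ∀ m : ι, ∃ B : lp (fun _ : ι × κ => E) p →L[𝕜] lp (fun _ : κ => E) p,
      ‖B‖ ≤ 1 ∧ ∀ y k, B y k = y (m, k) := fun m => by
    obtain ⟨B, h1, h2⟩ := lp_exists_op p (fun k : κ => (m, k))
      (fun _ => ContinuousLinearMap.id 𝕜 E)
      (fun a _ b _ h => (Prod.mk.inj h).2) zero_le_one (fun _ => ContinuousLinearMap.norm_id_le)
    exact ⟨B, h1, fun y k => by simp [h2]⟩
  choose R hR1 hR using hrow
  have hcurry : ∀ x : lp (fun _ : ι × κ => E) p,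
      ∃ z : lp (fun _ : ι => lp (fun _ : κ => E) p) p,
        (∀ m, z m = R m x) ∧ ‖z‖ ≤ 1 * ‖x‖ := fun x => by
    have hle : ∀ m, ‖R m x‖ ≤ ‖x‖ := fun m => by
      simpa using (R m).le_of_opNorm_le (hR1 m) x
    rcases eq_or_ne p ∞ with rfl | hp
    · refine ⟨⟨fun m => R m x, memℓp_infty ⟨‖x‖, ?_⟩⟩, fun _ => rfl, ?_⟩
      · rintro _ ⟨k, rfl⟩; exact hle k
      · rw [one_mul]; exact lp.norm_le_of_forall_le (norm_nonneg _) hle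
    · have hr := lp_exponent_toReal_pos hp
      have hsum : Summable fun q : ι × κ => ‖x q‖ ^ p.toReal := (lp.memℓp x).summable hr
      have hb : ∀ t : Finset ι, ∑ m ∈ t, ‖R m x‖ ^ p.toReal ≤ ‖x‖ ^ p.toReal := fun t => by
        have h1 : ∀ m, ‖R m x‖ ^ p.toReal = ∑' k, ‖x (m, k)‖ ^ p.toReal := fun m => by
          rw [lp.norm_rpow_eq_tsum hr]; simp [hR]
        rw [lp.norm_rpow_eq_tsum hr x, hsum.tsum_prod]
        simp_rw [h1]
        exact hsum.prod.sum_le_tsum t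
          (fun m _ => tsum_nonneg fun k => by positivity)
      refine ⟨⟨fun m => R m x, memℓp_gen' hb⟩, fun _ => rfl, ?_⟩
      rw [one_mul]
      exact lp.norm_le_of_forall_sum_le hr (norm_nonneg _) hb
  have hunc : ∀ z : lp (fun _ : ι => lp (fun _ : κ => E) p) p,
      ∃ x : lp (fun _ : ι × κ => E) p, (∀ q, x q = z q.1 q.2) ∧ ‖x‖ ≤ 1 * ‖z‖ := fun z => by
    rcases eq_or_ne p ∞ with rfl | hp
    · have hle : ∀ q : ι × κ, ‖z q.1 q.2‖ ≤ ‖z‖ := fun q =>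
        (lp.norm_apply_le_norm hp0 _ _).trans (lp.norm_apply_le_norm hp0 z _)
      refine ⟨⟨fun q => z q.1 q.2, memℓp_infty ⟨‖z‖, ?_⟩⟩, fun _ => rfl, ?_⟩
      · rintro _ ⟨k, rfl⟩; exact hle k
      · rw [one_mul]; exact lp.norm_le_of_forall_le (norm_nonneg _) hle
    · have hr := lp_exponent_toReal_pos hp
      have hb : ∀ t : Finset (ι × κ), ∑ q ∈ t, ‖z q.1 q.2‖ ^ p.toReal ≤ ‖z‖ ^ p.toReal :=
        fun t => by
          calc ∑ q ∈ t, ‖z q.1 q.2‖ ^ p.toReal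
              ≤ ∑ q ∈ t.image Prod.fst ×ˢ t.image Prod.snd, ‖z q.1 q.2‖ ^ p.toReal :=
                Finset.sum_le_sum_of_subset_of_nonneg Finset.subset_product
                  (fun _ _ _ => by positivity)
            _ = ∑ m ∈ t.image Prod.fst, ∑ k ∈ t.image Prod.snd, ‖z m k‖ ^ p.toReal :=
                Finset.sum_product _ _ _
            _ ≤ ∑ m ∈ t.image Prod.fst, ‖z m‖ ^ p.toReal :=
                Finset.sum_le_sum fun m _ => lp.sum_rpow_le_norm_rpow hr (z m) _
            _ ≤ ‖z‖ ^ p.toReal := lp.sum_rpow_le_norm_rpow hr z _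
      refine ⟨⟨fun q => z q.1 q.2, memℓp_gen' hb⟩, fun _ => rfl, ?_⟩
      rw [one_mul]
      exact lp.norm_le_of_forall_sum_le hr (norm_nonneg _) hb
  choose f hf hfn using hcurry
  choose g hg hgn using hunc
  refine ⟨ContinuousLinearEquiv.equivOfInverse
    (LinearMap.mkContinuous { toFun := f, map_add' := fun x y => ?_, map_smul' := fun c x => ?_ }
      1 hfn)
    (LinearMap.mkContinuous { toFun := g, map_add' := fun x y => ?_, map_smul' := fun c x => ?_ }
      1 hgn) (fun x => ?_) (fun x => ?_)⟩
  · ext m k; simp [hf]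
  · ext m k; simp [hf]
  · ext m; simp [hg]
  · ext m; simp [hg]
  · ext q; simp [hf, hg, hR]
  · ext m k; simp [hf, hg, hR]

end LpOperators

/-! ### Pełczyński's decomposition method. -/

section Decomposition

variable {𝕜 : Type*} [RCLike 𝕜]

theorem lp_nonempty_reindex (𝕜 : Type*) [RCLike 𝕜] (E : Type*) [NormedAddCommGroup E]
    [NormedSpace 𝕜 E] {ι κ : Type*} (e : κ ≃ ι) (p : ℝ≥0∞) [Fact (1 ≤ p)] :
    Nonempty (lp (fun _ : ι => E) p ≃L[𝕜] lp (fun _ : κ => E) p) := by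
  obtain ⟨f, -, hf⟩ := lp_exists_op p e (fun _ => ContinuousLinearMap.id 𝕜 E)
    e.injective.injOn zero_le_one (fun _ => ContinuousLinearMap.norm_id_le)
  obtain ⟨g, -, hg⟩ := lp_exists_op p e.symm (fun _ => ContinuousLinearMap.id 𝕜 E)
    e.symm.injective.injOn zero_le_one (fun _ => ContinuousLinearMap.norm_id_le)
  refine ⟨ContinuousLinearEquiv.equivOfInverse f g (fun x => ?_) (fun x => ?_)⟩
  · ext k; simp [hf, hg]
  · ext k; simp [hf, hg]

/-- The range of a projection on `X` is absorbed by `ℓᵖ(X)`. -/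
theorem lp_nonempty_absorb {X : Type*} [NormedAddCommGroup X] [NormedSpace 𝕜 X]
    (p : ℝ≥0∞) [Fact (1 ≤ p)] (Q : X →L[𝕜] X) (hQ : Q ∘L Q = Q) :
    Nonempty ((Q.range × lp (fun _ : ℕ => X) p) ≃L[𝕜] lp (fun _ : ℕ => X) p) := by
  have hQQ : ∀ x, Q (Q x) = Q x := fun x => congrArg (fun f : X →L[𝕜] X => f x) hQ
  have hQr : ∀ y : Q.range, Q (y : X) = y := by
    rintro ⟨_, x, rfl⟩; exact hQQ x
  set D : X →L[𝕜] X := ContinuousLinearMap.id 𝕜 X - Q with hD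
  have hDx : ∀ x, D x = x - Q x := fun x => rfl
  obtain ⟨A, -, hA⟩ := lp_exists_op p (id : ℕ → ℕ) (fun _ => D)
    Function.injective_id.injOn (norm_nonneg D) (fun _ => le_rfl)
  -- The isomorphism keeps the `D`-part of every entry in place, moves the `Q`-part one place to the
  -- right, and fills the vacant place 0 with the element of the range. Truncated subtraction makes
  -- places 0 and 1 both read entry 0, so the operator at place 0 is set to zero.
  obtain ⟨B, -, hB⟩ := lp_exists_op p (fun n : ℕ => n - 1)
    (fun n => if n = 0 then (0 : X →L[𝕜] X) else Q)
    (fun a ha b hb hab => by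
      have ha' : a ≠ 0 := by rintro rfl; simp at ha
      have hb' : b ≠ 0 := by rintro rfl; simp at hb
      simp only at hab; omega)
    (norm_nonneg Q) (fun n => by split_ifs <;> simp)
  obtain ⟨B', -, hB'⟩ := lp_exists_op p (fun n : ℕ => n + 1) (fun _ => Q)
    (fun a _ b _ hab => by simp only at hab; omega) (norm_nonneg Q) (fun _ => le_rfl)
  set s : X →L[𝕜] lp (fun _ : ℕ => X) p :=
    lp.singleContinuousLinearMap 𝕜 (fun _ : ℕ => X) p 0 with hs
  have hs0 : ∀ x, s x 0 = x := fun x => by simp [hs, lp.single_apply]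
  have hsn : ∀ x n, s x (n + 1) = 0 := fun x n => by simp [hs, lp.single_apply]
  set f : (Q.range × lp (fun _ : ℕ => X) p) →L[𝕜] lp (fun _ : ℕ => X) p :=
    (s ∘L Q.range.subtypeL).coprod (A + B) with hf
  have hf0 : ∀ y x, f (y, x) 0 = y + D (x 0) := fun y x => by
    simp [hf, hs0, hA, hB]
  have hfn : ∀ y x n, f (y, x) (n + 1) = D (x (n + 1)) + Q (x n) := fun y x n => by
    simp [hf, hsn, hA, hB]
  set g : lp (fun _ : ℕ => X) p →L[𝕜] (Q.range × lp (fun _ : ℕ => X) p) :=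
    ((Q.codRestrict Q.range (fun x => ⟨x, rfl⟩)) ∘L lp.evalCLM 𝕜 (fun _ : ℕ => X) p 0).prod
      (A + B') with hg
  have hg1 : ∀ z, ((g z).1 : X) = Q (z 0) := fun z => rfl
  have hg2 : ∀ z n, (g z).2 n = D (z n) + Q (z (n + 1)) := fun z n => by
    simp [hg, hA, hB']
  refine ⟨ContinuousLinearEquiv.equivOfInverse f g (fun yx => ?_) (fun z => ?_)⟩
  · obtain ⟨y, x⟩ := yx
    refine Prod.ext (Subtype.ext ?_) (lp.ext (funext fun n => ?_))
    · rw [hg1, hf0, hDx]; simp [hQQ, hQr]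
    · rw [hg2]
      rcases n with _ | n
      · rw [hf0, hfn]; simp [hDx, hQQ, hQr]
      · rw [hfn, hfn]; simp [hDx, hQQ]
  · refine lp.ext (funext fun n => ?_)
    have : g z = ((g z).1, (g z).2) := rfl
    rcases n with _ | n
    · rw [this, hf0, hg1, hg2]; simp [hDx, hQQ]
    · rw [this, hfn, hg2, hg2]; simp [hDx, hQQ]

/-- Pełczyński's decomposition method. -/
theorem lp_nonempty_range_equiv {E : Type*} [NormedAddCommGroup E] [NormedSpace 𝕜 E]
    {p : ℝ≥0∞} [Fact (1 ≤ p)]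
    (Q M N : lp (fun _ : ℕ => E) p →L[𝕜] lp (fun _ : ℕ => E) p) (hQ : Q ∘L Q = Q)
    (h : N ∘L Q ∘L M = ContinuousLinearMap.id 𝕜 _) :
    Nonempty (Q.range ≃L[𝕜] lp (fun _ : ℕ => E) p) := by
  obtain ⟨e₁⟩ := lp_nonempty_reindex 𝕜 E Nat.pairEquiv p
  obtain ⟨e₂⟩ := lp_nonempty_curry 𝕜 E ℕ ℕ p
  -- With `X = ℓᵖ(E)` this is `X ≅ ℓᵖ(X)`, so absorption of ranges by `ℓᵖ(X)` becomes absorption by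
  -- `X`.
  have e := e₁.trans e₂
  have absorb : ∀ P : lp (fun _ : ℕ => E) p →L[𝕜] lp (fun _ : ℕ => E) p, P ∘L P = P →
      Nonempty ((P.range × lp (fun _ : ℕ => E) p) ≃L[𝕜] lp (fun _ : ℕ => E) p) := by
    intro P hP
    obtain ⟨a⟩ := lp_nonempty_absorb p P hP
    exact ⟨(((ContinuousLinearEquiv.refl 𝕜 P.range).prodCongr e).trans a).trans e.symm⟩
  obtain ⟨a⟩ := absorb Q hQ
  -- The identity is a projection with range `X`, so this yields `X × X ≅ X`.
  obtain ⟨c⟩ := absorb (ContinuousLinearMap.id 𝕜 _) rfl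
  have hr : (ContinuousLinearMap.id 𝕜 (lp (fun _ : ℕ => E) p)).range = ⊤ := by
    ext x; simp
  have c' : (lp (fun _ : ℕ => E) p × lp (fun _ : ℕ => E) p) ≃L[𝕜] lp (fun _ : ℕ => E) p :=
    ((((ContinuousLinearEquiv.ofEq _ _ hr).trans
      Submodule.topContEquiv).symm).prodCongr (ContinuousLinearEquiv.refl 𝕜 _)).trans c
  set N' : Q.range →L[𝕜] lp (fun _ : ℕ => E) p := N ∘L Q.range.subtypeL
  set M' : lp (fun _ : ℕ => E) p →L[𝕜] Q.range :=
    (Q.codRestrict Q.range (fun x => ⟨x, rfl⟩)) ∘L M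
  have hNM : Function.RightInverse M' N' := fun x =>
    congrArg (fun f : lp (fun _ : ℕ => E) p →L[𝕜] lp (fun _ : ℕ => E) p => f x) h
  let d := ContinuousLinearEquiv.equivOfRightInverse N' M' hNM
  -- With `Z = ker N'` the chain is `ran Q ≅ X × Z ≅ (X × X) × Z ≅ X × (X × Z) ≅ X × ran Q ≅ X`.
  exact ⟨d.trans <| (c'.symm.prodCongr (ContinuousLinearEquiv.refl 𝕜 _)).trans <|
    (ContinuousLinearEquiv.prodAssoc 𝕜 _ _ _).trans <|
    ((ContinuousLinearEquiv.refl 𝕜 _).prodCongr d.symm).trans <|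
    (ContinuousLinearEquiv.prodComm 𝕜 _ _).trans a⟩

end Decomposition

/-! ### Subsymmetric systems and the consequences of condition (C). -/

theorem Set.Infinite.exists_infinite_of_cover {ι : Type*} {s : Set ι} (hs : s.Infinite) {N : ℕ}
    {P : ℕ → ι → Prop} (h : ∀ i ∈ s, ∃ j < N, P j i) : ∃ j < N, {i ∈ s | P j i}.Infinite := by
  by_contra! hc
  refine hs (((Set.finite_lt_nat N).biUnion (t := fun j => {i ∈ s | P j i})
    fun j hj => hc j hj).subset fun i hi => ?_)
  obtain ⟨j, hj, hP⟩ := h i hi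
  exact Set.mem_biUnion (show j ∈ {i | i < N} from hj) ⟨hi, hP⟩

theorem Set.Infinite.exists_strictMono_range {s : Set ℕ} (hs : s.Infinite) :
    ∃ n : ℕ → ℕ, StrictMono n ∧ Set.range n = s := by
  classical
  have := hs.to_subtype
  exact ⟨Nat.orderEmbeddingOfSet s, (Nat.orderEmbeddingOfSet s).strictMono,
    Nat.orderEmbeddingOfSet_range s⟩

theorem Set.Infinite.frequently_mem {s : Set ℕ} (hs : s.Infinite) : ∃ᶠ k in atTop, k ∈ s :=
  Nat.frequently_atTop_iff_infinite.2 hs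

/-- A biorthogonal system with bounded multipliers, bounded passage to subsequences, and the
property that scalar combinations of vectors with disjoint supports may have small norm. -/
structure SubsymmetricSystem (𝕜 E : Type*) [RCLike 𝕜] [NormedAddCommGroup E]
    [NormedSpace 𝕜 E] where
  /-- the coordinate functionals -/
  coord : ℕ → E →L[𝕜] 𝕜
  /-- the vectors of the system -/
  vec : ℕ → E
  /-- the constant of the multipliers -/
  K : ℝ
  /-- the constant of the subsequence maps -/
  L : ℝ
  /-- the multipliers -/
  mul : (ℕ → 𝕜) → E →L[𝕜] E
  norm_coord_le : ∀ i, ‖coord i‖ ≤ 1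
  norm_vec_le : ∀ i, ‖vec i‖ ≤ 1
  coord_vec : ∀ i j, coord i (vec j) = if i = j then 1 else 0
  ext : ∀ y z, (∀ i, coord i y = coord i z) → y = z
  norm_mul_le : ∀ γ, (∀ i, ‖γ i‖ ≤ 1) → ‖mul γ‖ ≤ K
  coord_mul : ∀ γ, (∀ i, ‖γ i‖ ≤ 1) → ∀ i y, coord i (mul γ y) = γ i * coord i y
  exists_spread : ∀ n : ℕ → ℕ, StrictMono n → ∃ S T : E →L[𝕜] E, ‖S‖ ≤ L ∧ ‖T‖ ≤ K * L ∧
    (∀ j y, coord (n j) (S y) = coord j y) ∧ (∀ i ∉ Set.range n, ∀ y, coord i (S y) = 0) ∧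
    ∀ j y, coord j (T y) = coord (n j) y
  exists_small : ∀ Λ : Set ℕ, Λ.Infinite → ∀ θ : ℝ, 0 < θ →
    ∃ A : ℕ → Set ℕ, (∀ j, A j ⊆ Λ ∧ (A j).Infinite) ∧ Pairwise (fun i j => Disjoint (A i) (A j)) ∧
      ∀ x : ℕ → E, (∀ j, ‖x j‖ ≤ 1) → ∃ a : ℕ → 𝕜, HasSum (fun j => ‖a j‖) 1 ∧
        ∃ z, HasSum (fun j => a j • mul ((A j).indicator 1) (x j)) z ∧ ‖z‖ ≤ θ

namespace SubsymmetricSystem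

variable {𝕜 E : Type*} [RCLike 𝕜] [NormedAddCommGroup E] [NormedSpace 𝕜 E]
  (B : SubsymmetricSystem 𝕜 E)

theorem K_nonneg : 0 ≤ B.K := (norm_nonneg _).trans (B.norm_mul_le 0 (by simp))

theorem L_nonneg : 0 ≤ B.L := by
  obtain ⟨S, -, hS, -⟩ := B.exists_spread id strictMono_id
  exact (norm_nonneg S).trans hS

/-- The projection onto the vectors supported in `A`. -/
noncomputable def proj (A : Set ℕ) : E →L[𝕜] E := B.mul (A.indicator 1)

theorem norm_indicator_le (A : Set ℕ) (i : ℕ) : ‖A.indicator (1 : ℕ → 𝕜) i‖ ≤ 1 := by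
  classical
  by_cases h : i ∈ A <;> simp [h]

theorem norm_proj_le (A : Set ℕ) : ‖B.proj A‖ ≤ B.K := B.norm_mul_le _ (norm_indicator_le A)

open Classical in
theorem coord_proj (A : Set ℕ) (i : ℕ) (y : E) :
    B.coord i (B.proj A y) = if i ∈ A then B.coord i y else 0 := by
  rw [proj, B.coord_mul _ (norm_indicator_le A)]
  by_cases h : i ∈ A <;> simp [h]

theorem proj_vec {A : Set ℕ} {i : ℕ} (hi : i ∈ A) : B.proj A (B.vec i) = B.vec i := by
  refine B.ext _ _ fun k => ?_
  rw [coord_proj, coord_vec]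
  split_ifs with h1 h2 <;> simp_all

/-- Multiplication of disjointly supported vectors by scalars in the unit ball. -/
theorem exists_hasSum_smul {A : ℕ → Set ℕ} (hA : Pairwise (fun i j => Disjoint (A i) (A j)))
    {x : ℕ → E} {a : ℕ → 𝕜} {z : E} (hz : HasSum (fun j => a j • B.proj (A j) (x j)) z)
    {c : ℕ → 𝕜} (hc : ∀ j, ‖c j‖ ≤ 1) :
    ∃ w, HasSum (fun j => (c j * a j) • B.proj (A j) (x j)) w ∧ ‖w‖ ≤ B.K * ‖z‖ := by
  classical
  set γ : ℕ → 𝕜 := fun i => if h : ∃ j, i ∈ A j then c h.choose else 0 with hγ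
  have hγ1 : ∀ i, ‖γ i‖ ≤ 1 := fun i => by
    simp only [hγ]; split_ifs
    · exact hc _
    · simp
  have hγA : ∀ j, ∀ i ∈ A j, γ i = c j := fun j i hi => by
    have h : ∃ j, i ∈ A j := ⟨j, hi⟩
    have : h.choose = j := by
      by_contra hne
      exact Set.disjoint_left.1 (hA hne) h.choose_spec hi
    simp only [hγ, dif_pos h, this]
  refine ⟨B.mul γ z, ?_, (B.mul γ).le_of_opNorm_le (B.norm_mul_le γ hγ1) z⟩
  have hfun : ∀ j, (c j * a j) • B.proj (A j) (x j) = B.mul γ (a j • B.proj (A j) (x j)) :=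
    fun j => by
      refine B.ext _ _ fun i => ?_
      rw [B.coord_mul γ hγ1, map_smul, map_smul, coord_proj]
      split_ifs with hi
      · rw [hγA j i hi, smul_eq_mul, smul_eq_mul, mul_assoc]
      · simp
  simp_rw [hfun]
  exact (B.mul γ).hasSum hz

/-- Unimodular multipliers, constant on each `A j`, rotate all terms `a j * φ (...)` to nonnegative
reals. By unconditionality this costs only a factor `K`. -/
theorem exists_hasSum_norm {A : ℕ → Set ℕ} (hA : Pairwise (fun i j => Disjoint (A i) (A j)))
    {x : ℕ → E} {a : ℕ → 𝕜} {z : E} (hz : HasSum (fun j => a j • B.proj (A j) (x j)) z)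
    (φ : E →L[𝕜] 𝕜) :
    ∃ s, HasSum (fun j => ‖a j‖ * ‖φ (B.proj (A j) (x j))‖) s ∧ s ≤ ‖φ‖ * (B.K * ‖z‖) := by
  choose c hc1 hc using fun j => RCLike.exists_norm_eq_mul_self (a j * φ (B.proj (A j) (x j)))
  obtain ⟨w, hw, hwz⟩ := B.exists_hasSum_smul hA hz (c := c) fun j => (hc1 j).le
  refine ⟨RCLike.reCLM (φ w), ?_, ?_⟩
  · have := RCLike.reCLM.hasSum (φ.hasSum hw)
    have hfun : ∀ j, RCLike.reCLM (φ ((c j * a j) • B.proj (A j) (x j))) =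
        ‖a j‖ * ‖φ (B.proj (A j) (x j))‖ := fun j => by
      simp only [map_smul, smul_eq_mul, RCLike.reCLM_apply]
      rw [mul_assoc, ← hc, RCLike.ofReal_re, norm_mul]
    simpa only [hfun] using this
  · rw [RCLike.reCLM_apply]
    exact (RCLike.re_le_norm _).trans ((φ.le_opNorm w).trans
      (mul_le_mul_of_nonneg_left hwz (norm_nonneg _)))

/-- A functional is small on the vectors supported in a suitable subset. -/
theorem exists_norm_comp_proj_le (φ : E →L[𝕜] 𝕜) {Λ : Set ℕ} (hΛ : Λ.Infinite) {θ : ℝ}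
    (hθ : 0 < θ) : ∃ A ⊆ Λ, A.Infinite ∧ ‖φ ∘L B.proj A‖ ≤ θ := by
  have hK := B.K_nonneg
  have hd : 0 < ‖φ‖ * B.K + 1 := by positivity
  obtain ⟨A, hA, hdis, h⟩ := B.exists_small Λ hΛ (θ / 2 / (‖φ‖ * B.K + 1)) (by positivity)
  by_contra! hc
  choose x hx1 hx using fun j =>
    (φ ∘L B.proj (A j)).exists_lt_apply_of_lt_opNorm (hc (A j) (hA j).1 (hA j).2)
  obtain ⟨a, ha, z, hz, hzθ⟩ := h x fun j => (hx1 j).le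
  obtain ⟨s, hs, hsz⟩ := B.exists_hasSum_norm hdis hz φ
  have h1 : θ ≤ s := by
    have := hasSum_le (fun j => mul_le_mul_of_nonneg_left (hx j).le (norm_nonneg (a j)))
      (ha.mul_right θ) hs
    simpa using this
  have h2 : ‖φ‖ * (B.K * ‖z‖) ≤ θ / 2 := by
    calc ‖φ‖ * (B.K * ‖z‖) ≤ (‖φ‖ * B.K + 1) * (θ / 2 / (‖φ‖ * B.K + 1)) := by
          rw [← mul_assoc]
          exact mul_le_mul (by linarith) hzθ (norm_nonneg _) hd.le
      _ = θ / 2 := by field_simp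
  linarith

/-- The system is weakly null, uniformly for its subsequences. -/
theorem exists_norm_apply_vec_le (C : ℝ) {δ : ℝ} (hδ : 0 < δ) :
    ∃ N, ∀ s : ℕ → ℕ, StrictMono s → ∀ φ : E →L[𝕜] 𝕜, ‖φ‖ ≤ C →
      ∃ j < N, ‖φ (B.vec (s j))‖ ≤ δ := by
  have hK := B.K_nonneg
  have hL := B.L_nonneg
  -- `D` bounds `‖φ ∘ S ∘ T‖ * K`, so the norm `δ / 4 / D` forces the sum of absolute values to be
  -- at most `δ / 4`; half of the `ℓ¹` mass lying below `N` would force at least `δ / 2`.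
  set D : ℝ := |C| * (B.L * (B.K * B.L)) * B.K + 1 with hD
  have hD0 : 0 < D := by positivity
  obtain ⟨A, hA, hdis, h⟩ := B.exists_small Set.univ Set.infinite_univ (δ / 4 / D) (by positivity)
  obtain ⟨k, hk, hkA⟩ := extraction_forall_of_frequently
    (P := fun j i => i ∈ A j) fun j => (hA j).2.frequently_mem
  obtain ⟨a, ha, z, hz, hzθ⟩ := h (fun j => B.vec (k j)) fun j => B.norm_vec_le _
  obtain ⟨N, hN⟩ : ∃ N, 1 / 2 < ∑ j ∈ Finset.range N, ‖a j‖ :=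
    (ha.tendsto_sum_nat.eventually_const_lt (by norm_num)).exists
  refine ⟨N, fun s hs φ hφ => ?_⟩
  by_contra! hc
  obtain ⟨S, -, hS, -, hS1, hS2, -⟩ := B.exists_spread s hs
  obtain ⟨-, T, -, hT, -, -, hT1⟩ := B.exists_spread k hk
  -- Compressing along `k` and spreading along `s` carries the test vectors to an arbitrary
  -- subsequence. This is why `N` depends on neither `s` nor `φ`.
  have hST : ∀ j, S (T (B.vec (k j))) = B.vec (s j) := fun j => by
    refine B.ext _ _ fun i => ?_
    by_cases hi : i ∈ Set.range s
    · obtain ⟨l, rfl⟩ := hi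
      rw [hS1, hT1, coord_vec, coord_vec]
      simp [hk.injective.eq_iff, hs.injective.eq_iff]
    · rw [hS2 i hi, coord_vec, if_neg]
      rintro rfl; exact hi ⟨j, rfl⟩
  obtain ⟨t, ht, htz⟩ := B.exists_hasSum_norm hdis hz (φ ∘L S ∘L T)
  have h1 : δ / 2 ≤ t := by
    calc δ / 2 ≤ (∑ j ∈ Finset.range N, ‖a j‖) * δ := by nlinarith
      _ = ∑ j ∈ Finset.range N, ‖a j‖ * δ := Finset.sum_mul _ _ _
      _ ≤ ∑ j ∈ Finset.range N,
          ‖a j‖ * ‖(φ ∘L S ∘L T) (B.proj (A j) (B.vec (k j)))‖ := by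
        refine Finset.sum_le_sum fun j hj => mul_le_mul_of_nonneg_left ?_ (norm_nonneg _)
        rw [B.proj_vec (hkA j)]
        simp only [ContinuousLinearMap.comp_apply, hST]
        exact (hc j (Finset.mem_range.1 hj)).le
      _ ≤ t := sum_le_hasSum _ (fun _ _ => by positivity) ht
  have h2 : ‖φ ∘L S ∘L T‖ ≤ |C| * (B.L * (B.K * B.L)) :=
    (ContinuousLinearMap.opNorm_comp_le _ _).trans <|
      mul_le_mul (hφ.trans (le_abs_self C)) ((ContinuousLinearMap.opNorm_comp_le _ _).trans
        (mul_le_mul hS hT (norm_nonneg _) hL)) (norm_nonneg _) (abs_nonneg C)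
  have h3 : ‖φ ∘L S ∘L T‖ * (B.K * ‖z‖) ≤ δ / 4 := by
    calc ‖φ ∘L S ∘L T‖ * (B.K * ‖z‖) ≤ D * (δ / 4 / D) := by
          rw [← mul_assoc]
          refine mul_le_mul ?_ hzθ (norm_nonneg _) hD0.le
          exact (mul_le_mul_of_nonneg_right h2 hK).trans (by linarith)
      _ = δ / 4 := by field_simp
  linarith

/-- Either the all-ones sequence belongs to the space, or all coordinate sequences are null. -/
theorem exists_one_or_finite : (∃ e, ∀ i, B.coord i e = 1) ∨
    ∀ y, ∀ δ : ℝ, 0 < δ → {i | δ ≤ ‖B.coord i y‖}.Finite := by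
  by_contra! h
  obtain ⟨h1, y, δ, hδ, hinf⟩ := h
  -- Coordinates of modulus at least `δ` are pulled back to all of `ℕ` and normalized to `δ` by a
  -- bounded multiplier, which produces the all-ones sequence.
  obtain ⟨n, hn, hnr⟩ := Set.Infinite.exists_strictMono_range hinf
  obtain ⟨-, T, -, -, -, -, hT⟩ := B.exists_spread n hn
  have hz : ∀ j, δ ≤ ‖B.coord j (T y)‖ := fun j => by
    rw [hT]
    have : n j ∈ {i | δ ≤ ‖B.coord i y‖} := hnr ▸ ⟨j, rfl⟩
    exact this
  have hz0 : ∀ j, B.coord j (T y) ≠ 0 := fun j => norm_pos_iff.1 (hδ.trans_le (hz j))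
  have hγ : ∀ j, ‖(δ : 𝕜) / B.coord j (T y)‖ ≤ 1 := fun j => by
    rw [norm_div, RCLike.norm_ofReal, abs_of_pos hδ]
    exact div_le_one_of_le₀ (hz j) (norm_nonneg _)
  obtain ⟨i, hi⟩ := h1 ((δ : 𝕜)⁻¹ • B.mul (fun j => (δ : 𝕜) / B.coord j (T y)) (T y))
  refine hi ?_
  have hδ' : (δ : 𝕜) ≠ 0 := by exact_mod_cast hδ.ne'
  rw [map_smul, B.coord_mul _ hγ, div_mul_cancel₀ _ (hz0 i), smul_eq_mul, inv_mul_cancel₀ hδ']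

/-- If the all-ones element exists, an element with coordinates bounded by `δ` is `δ` times a
bounded multiplier applied to it; the norm is then controlled by the supremum of the coordinates. -/
theorem norm_proj_le_of_one {e : E} (he : ∀ i, B.coord i e = 1) {A : Set ℕ} {y : E} {δ : ℝ}
    (hδ : 0 < δ) (hy : ∀ i ∈ A, ‖B.coord i y‖ ≤ δ) : ‖B.proj A y‖ ≤ δ * (B.K * ‖e‖) := by
  classical
  set γ : ℕ → 𝕜 := fun i => if i ∈ A then B.coord i y / (δ : 𝕜) else 0 with hγ
  have hδ' : (δ : 𝕜) ≠ 0 := by exact_mod_cast hδ.ne'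
  have hγ1 : ∀ i, ‖γ i‖ ≤ 1 := fun i => by
    simp only [hγ]; split_ifs with h
    · rw [norm_div, RCLike.norm_ofReal, abs_of_pos hδ]
      exact div_le_one_of_le₀ (hy i h) hδ.le
    · simp
  have : B.proj A y = (δ : 𝕜) • B.mul γ e := by
    refine B.ext _ _ fun i => ?_
    rw [coord_proj, map_smul, B.coord_mul _ hγ1, he]
    simp only [hγ]; split_ifs
    · rw [mul_one, smul_eq_mul, mul_div_cancel₀ _ hδ']
    · simp
  rw [this, norm_smul, RCLike.norm_ofReal, abs_of_pos hδ]
  exact mul_le_mul_of_nonneg_left ((B.mul γ).le_of_opNorm_le (B.norm_mul_le γ hγ1) e) hδ.le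

/-- When the coordinates along `k` are summable, the projection is the norm-convergent series of its
coordinates, even though the vectors need not span a dense subspace. -/
theorem norm_proj_range_le [CompleteSpace E] {k : ℕ → ℕ} (hk : StrictMono k) {y : E} {b : ℕ → ℝ}
    {ε : ℝ} (hb : HasSum b ε) (h : ∀ j, ‖B.coord (k j) y‖ ≤ b j) :
    ‖B.proj (Set.range k) y‖ ≤ ε := by
  have hle : ∀ j, ‖B.coord (k j) y • B.vec (k j)‖ ≤ b j := fun j => by
    rw [norm_smul]
    exact (mul_le_of_le_one_right (norm_nonneg _) (B.norm_vec_le _)).trans (h j)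
  have hs : Summable fun j => B.coord (k j) y • B.vec (k j) :=
    Summable.of_norm_bounded hb.summable hle
  have : B.proj (Set.range k) y = ∑' j, B.coord (k j) y • B.vec (k j) := by
    refine B.ext _ _ fun i => ?_
    rw [(B.coord i).map_tsum hs, coord_proj]
    simp only [map_smul, coord_vec]
    split_ifs with hi
    · obtain ⟨l, rfl⟩ := hi
      rw [tsum_eq_single l]
      · simp
      · intro j hj
        simp [hk.injective.eq_iff, hj.symm]
    · refine ((tsum_congr fun j => ?_).trans tsum_zero).symm
      rw [if_neg (fun h => hi ⟨j, h.symm⟩), smul_zero]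
  rw [this]
  exact tsum_of_norm_bounded hb hle

/-- Among sufficiently many vectors of the system one is mapped by a given operator to a vector
that is small on a suitable infinite subset. -/
theorem exists_norm_proj_apply_vec_le [CompleteSpace E] (C : ℝ) {ε : ℝ} (hε : 0 < ε) :
    ∃ N, ∀ U : E →L[𝕜] E, ‖U‖ ≤ C → ∀ Λ : Set ℕ, Λ.Infinite → ∀ s : ℕ → ℕ, StrictMono s →
      ∃ j < N, ∃ A ⊆ Λ, A.Infinite ∧ ‖B.proj A (U (B.vec (s j)))‖ ≤ ε := by
  have hK := B.K_nonneg
  rcases B.exists_one_or_finite with ⟨e, he⟩ | h0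
  · set d : ℝ := B.K * ‖e‖ + 1 with hd
    have hd0 : 0 < d := by positivity
    obtain ⟨N, hN⟩ := B.exists_norm_apply_vec_le C (δ := ε / d) (by positivity)
    refine ⟨N, fun U hU Λ hΛ s hs => ?_⟩
    -- For every `i ∈ Λ` some `j < N` makes coordinate `i` small, and finitely many `j` cover the
    -- infinite set `Λ`.
    obtain ⟨j, hj, hinf⟩ := hΛ.exists_infinite_of_cover
      (P := fun j i => ‖B.coord i (U (B.vec (s j)))‖ ≤ ε / d) fun i _ =>
        hN s hs (B.coord i ∘L U) ((ContinuousLinearMap.opNorm_comp_le _ _).trans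
          ((mul_le_of_le_one_left (norm_nonneg _) (B.norm_coord_le i)).trans hU))
    refine ⟨j, hj, _, Set.sep_subset _ _, hinf, ?_⟩
    calc _ ≤ ε / d * (B.K * ‖e‖) :=
          B.norm_proj_le_of_one he (by positivity) fun i hi => hi.2
      _ ≤ ε / d * d := by gcongr; linarith
      _ = ε := by field_simp
  -- For null coordinate sequences any vector works, hence `N = 1`: a sparse subset makes the
  -- coordinates summable with sum at most `ε`.
  · refine ⟨1, fun U _ Λ hΛ s _ => ⟨0, zero_lt_one, ?_⟩⟩
    obtain ⟨k, hk, hkΛ⟩ := extraction_forall_of_frequently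
      (P := fun j i => i ∈ Λ ∧ ‖B.coord i (U (B.vec (s 0)))‖ ≤ ε / 2 / 2 ^ j) fun j => by
        have hfin := h0 (U (B.vec (s 0))) (ε / 2 / 2 ^ j) (by positivity)
        refine ((hΛ.sdiff hfin).mono fun i hi => ?_).frequently_mem
        exact ⟨hi.1, (not_le.1 hi.2).le⟩
    refine ⟨Set.range k, ?_, Set.infinite_range_of_injective hk.injective,
      B.norm_proj_range_le hk (hasSum_geometric_two' ε) fun j => (hkΛ j).2⟩
    rintro _ ⟨j, rfl⟩; exact (hkΛ j).1

end SubsymmetricSystem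

/-! ### Coordinates of `ℓᵖ(E)` and large index sets. -/

namespace SubsymmetricSystem

variable {𝕜 E : Type*} [RCLike 𝕜] [NormedAddCommGroup E] [NormedSpace 𝕜 E]
  (B : SubsymmetricSystem 𝕜 E) (p : ℝ≥0∞) [Fact (1 ≤ p)]

/-- The projection of `ℓᵖ(E)` onto the elements supported in `R`. -/
noncomputable def lpProj (R : Set (ℕ × ℕ)) :
    lp (fun _ : ℕ => E) p →L[𝕜] lp (fun _ : ℕ => E) p :=
  (lp_exists_op p (id : ℕ → ℕ) (fun m => B.proj (Prod.mk m ⁻¹' R)) Function.injective_id.injOn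
    B.K_nonneg fun _ => B.norm_proj_le _).choose

/-- The coordinate functionals of `ℓᵖ(E)`. -/
noncomputable def lpCoord (q : ℕ × ℕ) : lp (fun _ : ℕ => E) p →L[𝕜] 𝕜 :=
  B.coord q.2 ∘L lp.evalCLM 𝕜 (fun _ : ℕ => E) p q.1

/-- The unit vectors of `ℓᵖ(E)`. -/
noncomputable def lpVec (q : ℕ × ℕ) : lp (fun _ : ℕ => E) p := lp.single p q.1 (B.vec q.2)

variable {p}

theorem norm_lpProj_le (R : Set (ℕ × ℕ)) : ‖B.lpProj p R‖ ≤ B.K :=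
  (lp_exists_op p (id : ℕ → ℕ) (fun m => B.proj (Prod.mk m ⁻¹' R)) Function.injective_id.injOn
    B.K_nonneg fun _ => B.norm_proj_le _).choose_spec.1

theorem lpProj_apply (R : Set (ℕ × ℕ)) (y : lp (fun _ : ℕ => E) p) (m : ℕ) :
    B.lpProj p R y m = B.proj (Prod.mk m ⁻¹' R) (y m) :=
  (lp_exists_op p (id : ℕ → ℕ) (fun m => B.proj (Prod.mk m ⁻¹' R)) Function.injective_id.injOn
    B.K_nonneg fun _ => B.norm_proj_le _).choose_spec.2 y m

theorem norm_lpProj_apply_le (R : Set (ℕ × ℕ)) (y : lp (fun _ : ℕ => E) p) :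
    ‖B.lpProj p R y‖ ≤ B.K * ‖y‖ :=
  (B.lpProj p R).le_of_opNorm_le (B.norm_lpProj_le R) y

theorem lpCoord_apply (q : ℕ × ℕ) (y : lp (fun _ : ℕ => E) p) :
    B.lpCoord p q y = B.coord q.2 (y q.1) := rfl

theorem norm_lpCoord_apply_le (q : ℕ × ℕ) (y : lp (fun _ : ℕ => E) p) :
    ‖B.lpCoord p q y‖ ≤ ‖y‖ := by
  have := (B.coord q.2).le_of_opNorm_le (B.norm_coord_le _) (y q.1)
  rw [one_mul] at this
  exact this.trans (lp.norm_apply_le_norm (lp_exponent_ne_zero p) y _)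

theorem norm_lpVec_le (q : ℕ × ℕ) : ‖B.lpVec p q‖ ≤ 1 := by
  rw [lpVec, lp.norm_single (pos_iff_ne_zero.2 (lp_exponent_ne_zero p))]
  exact B.norm_vec_le _

theorem lpCoord_lpVec (q r : ℕ × ℕ) : B.lpCoord p q (B.lpVec p r) = if q = r then 1 else 0 := by
  rw [lpCoord_apply, lpVec, lp.single_apply]
  obtain ⟨m, i⟩ := q
  obtain ⟨n, j⟩ := r
  by_cases h : m = n
  · subst h; simp [coord_vec]
  · simp [h]

theorem lp_ext {y z : lp (fun _ : ℕ => E) p} (h : ∀ q, B.lpCoord p q y = B.lpCoord p q z) :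
    y = z :=
  lp.ext (funext fun m => B.ext _ _ fun i => h (m, i))

open Classical in
theorem lpCoord_lpProj (R : Set (ℕ × ℕ)) (q : ℕ × ℕ) (y : lp (fun _ : ℕ => E) p) :
    B.lpCoord p q (B.lpProj p R y) = if q ∈ R then B.lpCoord p q y else 0 := by
  rw [lpCoord_apply, lpProj_apply, coord_proj]; rfl

theorem lpProj_lpProj (R R' : Set (ℕ × ℕ)) (y : lp (fun _ : ℕ => E) p) :
    B.lpProj p R (B.lpProj p R' y) = B.lpProj p (R ∩ R') y := by
  refine B.lp_ext fun q => ?_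
  simp only [lpCoord_lpProj, Set.mem_inter_iff]
  by_cases h : q ∈ R <;> by_cases h' : q ∈ R' <;> simp [h, h']

theorem proj_empty : B.proj ∅ = 0 := by
  ext y; exact B.ext _ _ fun i => by simp [coord_proj]

end SubsymmetricSystem

/-- All rows of `R` indexed by elements of `F`, and infinitely many of the rows of `R`, are
infinite. -/
structure IsLarge (F : Finset ℕ) (R : Set (ℕ × ℕ)) : Prop where
  infinite_row : ∀ m ∈ F, (Prod.mk m ⁻¹' R).Infinite
  infinite_rows : {m | (Prod.mk m ⁻¹' R).Infinite}.Infinite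

/-- The set with rows `A m` for `m ∈ F` and the rows of `R` otherwise. -/
def replaceRows (F : Finset ℕ) (A : ℕ → Set ℕ) (R : Set (ℕ × ℕ)) : Set (ℕ × ℕ) :=
  {q | (q.1 ∈ F ∧ q.2 ∈ A q.1) ∨ (q.1 ∉ F ∧ q ∈ R)}

section ReplaceRows

variable {F : Finset ℕ} {A : ℕ → Set ℕ} {R R₀ : Set (ℕ × ℕ)}

theorem preimage_replaceRows_of_mem {m : ℕ} (hm : m ∈ F) :
    Prod.mk m ⁻¹' replaceRows F A R = A m := by
  ext i; simp [replaceRows, hm]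

theorem preimage_replaceRows_of_notMem {m : ℕ} (hm : m ∉ F) :
    Prod.mk m ⁻¹' replaceRows F A R = Prod.mk m ⁻¹' R := by
  ext i; simp [replaceRows, hm]

theorem replaceRows_subset (hA : ∀ m ∈ F, A m ⊆ Prod.mk m ⁻¹' R₀) (hR : R ⊆ R₀) :
    replaceRows F A R ⊆ R₀ := by
  rintro ⟨m, i⟩ (⟨h1, h2⟩ | ⟨-, h⟩)
  · exact hA m h1 h2
  · exact hR h

theorem isLarge_replaceRows (hA : ∀ m ∈ F, (A m).Infinite)
    (hR : {m | (Prod.mk m ⁻¹' R).Infinite}.Infinite) : IsLarge F (replaceRows F A R) where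
  infinite_row m hm := by rw [preimage_replaceRows_of_mem hm]; exact hA m hm
  infinite_rows := by
    refine (hR.sdiff F.finite_toSet).mono fun m hm => ?_
    have : m ∉ F := fun h => hm.2 (Finset.mem_coe.2 h)
    simpa only [Set.mem_ofPred_eq, preimage_replaceRows_of_notMem this] using hm.1

end ReplaceRows

/-! ### Small functionals and small columns on large index sets. -/

namespace SubsymmetricSystem

variable {𝕜 E : Type*} [RCLike 𝕜] [NormedAddCommGroup E] [NormedSpace 𝕜 E]
  (B : SubsymmetricSystem 𝕜 E) {p : ℝ≥0∞} [Fact (1 ≤ p)]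

theorem lpProj_replaceRows (F : Finset ℕ) (A : ℕ → Set ℕ) {R : Set (ℕ × ℕ)}
    (hR : ∀ q ∈ R, q.1 ∉ F) (y : lp (fun _ : ℕ => E) p) :
    B.lpProj p (replaceRows F A R) y =
      ∑ m ∈ F, lp.single p m (B.proj (A m) (y m)) + B.lpProj p R y := by
  refine lp.ext (funext fun m => ?_)
  rw [lp.coeFn_add, lp.coeFn_sum, Pi.add_apply, Finset.sum_apply, lpProj_apply, lpProj_apply]
  by_cases hm : m ∈ F
  · have h0 : Prod.mk m ⁻¹' R = ∅ := by
      ext i; simpa using fun h => hR _ h hm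
    rw [preimage_replaceRows_of_mem hm, Finset.sum_eq_single_of_mem m hm, lp.single_apply_self, h0,
      proj_empty]
    · simp
    · intro k _ hk
      exact lp.single_apply_ne _ _ _ hk.symm
  · rw [preimage_replaceRows_of_notMem hm, Finset.sum_eq_zero, zero_add]
    intro k hk
    exact lp.single_apply_ne _ _ _ (by rintro rfl; exact hm hk)

/-- A functional on `ℓ^∞(E)` is small on suitable infinite sets of rows. -/
theorem exists_infinite_norm_comp_lpProj_le (φ : lp (fun _ : ℕ => E) ∞ →L[𝕜] 𝕜)
    (R : Set (ℕ × ℕ)) {P : Set ℕ} (hP : P.Infinite) {ε : ℝ} (hε : 0 < ε) :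
    ∃ P' ⊆ P, P'.Infinite ∧ ‖φ ∘L B.lpProj ∞ (R ∩ {q | q.1 ∈ P'})‖ ≤ ε := by
  classical
  have hK := B.K_nonneg
  obtain ⟨n, hn, hnP⟩ := hP.exists_strictMono_range
  -- The pairing function splits `P` into infinitely many disjoint infinite sets of rows. If none of
  -- them worked, norming pieces over `N` of them would add up to an element of norm at most `K` on
  -- which `φ` is at least `N * ε`.
  set Q : ℕ → Set ℕ := fun a => Set.range fun b => n (Nat.pair a b) with hQ
  by_contra! hc
  have hQP : ∀ a, Q a ⊆ P := fun a => by
    rw [← hnP]; rintro _ ⟨b, rfl⟩; exact ⟨_, rfl⟩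
  have hQi : ∀ a, (Q a).Infinite := fun a => Set.infinite_range_of_injective fun b c h => by
    simpa using hn.injective h
  have hQd : ∀ a b m, m ∈ Q a → m ∈ Q b → a = b := by
    rintro a b _ ⟨c, rfl⟩ ⟨d, hd⟩
    exact (Nat.pair_eq_pair.1 (hn.injective hd)).1.symm
  choose y hy1 hy using fun a =>
    (φ ∘L B.lpProj ∞ (R ∩ {q | q.1 ∈ Q a})).exists_lt_apply_of_lt_opNorm (hc _ (hQP a) (hQi a))
  choose c hc1 hc2 using fun a =>
    RCLike.exists_norm_eq_mul_self (φ (B.lpProj ∞ (R ∩ {q | q.1 ∈ Q a}) (y a)))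
  obtain ⟨N, hN⟩ := exists_nat_gt (‖φ‖ * B.K / ε)
  set z := ∑ a ∈ Finset.range N, c a • B.lpProj ∞ (R ∩ {q | q.1 ∈ Q a}) (y a) with hz
  have hterm : ∀ a m, m ∉ Q a → (B.lpProj ∞ (R ∩ {q | q.1 ∈ Q a}) (y a)) m = 0 :=
    fun a m hm => by
      have : Prod.mk m ⁻¹' (R ∩ {q | q.1 ∈ Q a}) = ∅ := by ext i; simp [hm]
      rw [lpProj_apply, this, proj_empty]; rfl
  have hzK : ‖z‖ ≤ B.K := by
    refine lp.norm_le_of_forall_le hK fun m => ?_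
    rw [hz, lp.coeFn_sum, Finset.sum_apply]
    by_cases hm : ∃ a ∈ Finset.range N, m ∈ Q a
    · obtain ⟨a, ha, hma⟩ := hm
      rw [Finset.sum_eq_single_of_mem a ha, lp.coeFn_smul, Pi.smul_apply, norm_smul, hc1, one_mul]
      · refine (lp.norm_apply_le_norm ENNReal.top_ne_zero _ m).trans
          ((B.norm_lpProj_apply_le _ _).trans ?_)
        exact mul_le_of_le_one_right hK (hy1 a).le
      · intro b _ hb
        rw [lp.coeFn_smul, Pi.smul_apply, hterm b m fun h => hb (hQd _ _ _ h hma), smul_zero]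
    · rw [Finset.sum_eq_zero, norm_zero]
      · exact hK
      · intro a ha
        rw [lp.coeFn_smul, Pi.smul_apply, hterm a m fun h => hm ⟨a, ha, h⟩, smul_zero]
  have hφz : φ z = ((∑ a ∈ Finset.range N,
      ‖φ (B.lpProj ∞ (R ∩ {q | q.1 ∈ Q a}) (y a))‖ : ℝ) : 𝕜) := by
    rw [hz, map_sum, RCLike.ofReal_sum]
    exact Finset.sum_congr rfl fun a _ => by rw [map_smul, smul_eq_mul, ← hc2]
  have h1 : N * ε ≤ ‖φ z‖ := by
    rw [hφz, RCLike.norm_ofReal]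
    refine le_trans ?_ (le_abs_self _)
    calc (N : ℝ) * ε = ∑ _a ∈ Finset.range N, ε := by simp
      _ ≤ _ := Finset.sum_le_sum fun a _ => (hy a).le
  have h2 : ‖φ z‖ ≤ ‖φ‖ * B.K := (φ.le_opNorm z).trans (by gcongr)
  rw [div_lt_iff₀ hε] at hN
  linarith

/-- A functional on `ℓᵖ(E)` is small on the elements supported in a suitable large subset. -/
theorem exists_isLarge_norm_comp_le (φ : lp (fun _ : ℕ => E) p →L[𝕜] 𝕜) {F : Finset ℕ}
    {R : Set (ℕ × ℕ)} (hR : IsLarge F R) {ε : ℝ} (hε : 0 < ε) :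
    ∃ R' ⊆ R, IsLarge F R' ∧ ‖φ ∘L B.lpProj p R'‖ ≤ ε := by
  classical
  have hK := B.K_nonneg
  have hp0 := lp_exponent_ne_zero p
  have key : ∀ m, ∃ A ⊆ Prod.mk m ⁻¹' R, ((Prod.mk m ⁻¹' R).Infinite → A.Infinite) ∧
      ‖(φ ∘L lp.singleContinuousLinearMap 𝕜 (fun _ : ℕ => E) p m) ∘L B.proj A‖ ≤
        ε / 2 / 2 / 2 ^ m := fun m => by
    by_cases hm : (Prod.mk m ⁻¹' R).Infinite
    · obtain ⟨A, hA, hAi, hAn⟩ := B.exists_norm_comp_proj_le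
        (φ ∘L lp.singleContinuousLinearMap 𝕜 (fun _ : ℕ => E) p m) hm
        (θ := ε / 2 / 2 / 2 ^ m) (by positivity)
      exact ⟨A, hA, fun _ => hAi, hAn⟩
    · refine ⟨∅, Set.empty_subset _, fun h => absurd h hm, ?_⟩
      rw [proj_empty, ContinuousLinearMap.comp_zero, norm_zero]
      positivity
  choose A hA hAi hAn using key
  have hAn' : ∀ m (y : lp (fun _ : ℕ => E) p),
      ‖φ (lp.single p m (B.proj (A m) (y m)))‖ ≤ ε / 2 / 2 / 2 ^ m * ‖y‖ := fun m y =>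
    ((ContinuousLinearMap.le_of_opNorm_le _ (hAn m) (y m))).trans
      (mul_le_mul_of_nonneg_left (lp.norm_apply_le_norm hp0 y m) (by positivity))
  have hgeo := hasSum_geometric_two' (ε / 2)
  set R₁ : Set (ℕ × ℕ) := {q | q.2 ∈ A q.1} with hR₁
  have hrow : ∀ m, Prod.mk m ⁻¹' R₁ = A m := fun m => rfl
  have hR₁R : R₁ ⊆ R := fun q hq => hA q.1 hq
  -- For `p < ∞` an element is the norm sum of its rows, so the row estimates suffice. For `p = ∞`
  -- they control only finitely many rows, and the rows outside `F` are thinned out to a set on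
  -- which `φ` is small as a whole.
  rcases eq_or_ne p ∞ with rfl | hp
  · have hP : ({m | (Prod.mk m ⁻¹' R).Infinite} \ (F : Set ℕ)).Infinite :=
      hR.infinite_rows.sdiff F.finite_toSet
    obtain ⟨P, hPP, hPi, hPn⟩ := B.exists_infinite_norm_comp_lpProj_le φ R₁ hP (half_pos hε)
    refine ⟨replaceRows F A (R₁ ∩ {q | q.1 ∈ P}),
      replaceRows_subset (fun m _ => hA m) (Set.inter_subset_left.trans hR₁R),
      isLarge_replaceRows (fun m hm => hAi m (hR.infinite_row m hm)) ?_, ?_⟩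
    · refine hPi.mono fun m hm => ?_
      have : Prod.mk m ⁻¹' (R₁ ∩ {q | q.1 ∈ P}) = A m := by
        ext i; simp [hR₁, hm]
      rw [Set.mem_ofPred_eq, this]
      exact hAi m (hPP hm).1
    · refine ContinuousLinearMap.opNorm_le_bound _ hε.le fun y => ?_
      rw [ContinuousLinearMap.comp_apply,
        B.lpProj_replaceRows F A fun q hq h => (hPP hq.2).2 (Finset.mem_coe.2 h), map_add, map_sum]
      have h1 : ‖∑ m ∈ F, φ (lp.single ∞ m (B.proj (A m) (y m)))‖ ≤ ε / 2 * ‖y‖ := by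
        refine (norm_sum_le_of_le F fun m _ => hAn' m y).trans ?_
        rw [← Finset.sum_mul]
        exact mul_le_mul_of_nonneg_right
          (sum_le_hasSum F (fun _ _ => by positivity) hgeo) (norm_nonneg _)
      have h2 := ContinuousLinearMap.le_of_opNorm_le _ hPn y
      rw [ContinuousLinearMap.comp_apply] at h2
      refine (norm_add_le_of_le h1 h2).trans (le_of_eq (by ring))
  · refine ⟨R₁, hR₁R, ⟨fun m hm => hAi m (hR.infinite_row m hm),
      hR.infinite_rows.mono fun m hm => hAi m hm⟩, ?_⟩
    refine ContinuousLinearMap.opNorm_le_bound _ hε.le fun y => ?_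
    have h1 := φ.hasSum (lp.hasSum_single hp (B.lpProj p R₁ y))
    rw [ContinuousLinearMap.comp_apply, ← h1.tsum_eq]
    refine (tsum_of_norm_bounded (hgeo.mul_right ‖y‖) fun m => ?_).trans
      (mul_le_mul_of_nonneg_right (by linarith) (norm_nonneg _))
    rw [lpProj_apply, hrow]
    exact hAn' m y

/-- Some vector in a prescribed row is mapped by a given operator to an element which is small on
a suitable large subset. -/
theorem exists_isLarge_norm_lpProj_apply_le [CompleteSpace E]
    (H : lp (fun _ : ℕ => E) p →L[𝕜] lp (fun _ : ℕ => E) p) {F : Finset ℕ}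
    {R : Set (ℕ × ℕ)} (hR : IsLarge F R) {n : ℕ} (hn : n ∈ F) {ε : ℝ} (hε : 0 < ε) :
    ∃ j, (n, j) ∈ R ∧ ∃ R' ⊆ R, IsLarge F R' ∧ ‖B.lpProj p R' (H (B.lpVec p (n, j)))‖ ≤ ε := by
  classical
  have hK := B.K_nonneg
  have hp0 := lp_exponent_ne_zero p
  set U : ℕ → E →L[𝕜] E := fun m => lp.evalCLM 𝕜 (fun _ : ℕ => E) p m ∘L H ∘L
    lp.singleContinuousLinearMap 𝕜 (fun _ : ℕ => E) p n with hU
  have hUv : ∀ m j, U m (B.vec j) = H (B.lpVec p (n, j)) m := fun m j => rfl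
  have hUn : ∀ m, ‖U m‖ ≤ ‖H‖ := fun m => by
    refine ContinuousLinearMap.opNorm_le_bound _ (norm_nonneg H) fun x => ?_
    refine (lp.norm_apply_le_norm hp0 (H (lp.single p n x)) m).trans ((H.le_opNorm _).trans ?_)
    rw [lp.norm_single (pos_iff_ne_zero.2 hp0)]
  set η : ℝ := ε / 2 / (F.card + 1) with hη
  have hη0 : 0 < η := by positivity
  -- Infinitely many bad `j` would form a subsequence contradicting `exists_norm_proj_apply_vec_le`.
  -- Discarding the bad `j` for all `m ∈ F` leaves indices that serve every row of `F`.
  have hbad : ∀ m ∈ F, {j | ¬ ∃ A ⊆ Prod.mk m ⁻¹' R, A.Infinite ∧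
      ‖B.proj A (U m (B.vec j))‖ ≤ η}.Finite := fun m hm => by
    by_contra hinf
    obtain ⟨s, hs, hsr⟩ := Set.Infinite.exists_strictMono_range hinf
    obtain ⟨N, hN⟩ := B.exists_norm_proj_apply_vec_le ‖H‖ hη0
    obtain ⟨j, -, h⟩ := hN (U m) (hUn m) _ (hR.infinite_row m hm) s hs
    have : s j ∈ {j | ¬ ∃ A ⊆ Prod.mk m ⁻¹' R, A.Infinite ∧
      ‖B.proj A (U m (B.vec j))‖ ≤ η} := hsr ▸ ⟨j, rfl⟩
    exact this h
  obtain ⟨s, hs, hsr⟩ := ((hR.infinite_row n hn).sdiff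
    (F.finite_toSet.biUnion hbad)).exists_strictMono_range
  have hs1 : ∀ j, (n, s j) ∈ R := fun j => (hsr.subset ⟨j, rfl⟩).1
  have hs2 : ∀ j, ∀ m ∈ F, ∃ A ⊆ Prod.mk m ⁻¹' R, A.Infinite ∧
      ‖B.proj A (U m (B.vec (s j)))‖ ≤ η := fun j m hm => by
    by_contra h
    exact (hsr.subset ⟨j, rfl⟩).2 (Set.mem_biUnion (Finset.mem_coe.2 hm) h)
  have hP : ({m | (Prod.mk m ⁻¹' R).Infinite} \ (F : Set ℕ)).Infinite :=
    hR.infinite_rows.sdiff F.finite_toSet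
  obtain ⟨j, R₀, hR₀, hR₀F, hR₀i, hR₀n⟩ : ∃ j, ∃ R₀ ⊆ R, (∀ q ∈ R₀, q.1 ∉ F) ∧
      {m | (Prod.mk m ⁻¹' R₀).Infinite}.Infinite ∧
      ‖B.lpProj p R₀ (H (B.lpVec p (n, s j)))‖ ≤ ε / 2 := by
    -- For `p = ∞` the uniform `N` lets one index `j` serve infinitely many rows, and the supremum
    -- norm only needs each row small. For `p < ∞` any fixed vector has a small tail, so it is
    -- enough to drop finitely many rows.
    rcases eq_or_ne p ∞ with rfl | hp
    · obtain ⟨N, hN⟩ := B.exists_norm_proj_apply_vec_le ‖H‖ (half_pos hε)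
      obtain ⟨j, -, hj⟩ := hP.exists_infinite_of_cover (N := N)
        (P := fun j m => ∃ A ⊆ Prod.mk m ⁻¹' R, A.Infinite ∧
          ‖B.proj A (U m (B.vec (s j)))‖ ≤ ε / 2)
        fun m hm => hN (U m) (hUn m) _ hm.1 s hs
      choose! A hA hAi hAn using fun m
        (hm : m ∈ {i ∈ {m | (Prod.mk m ⁻¹' R).Infinite} \ (F : Set ℕ) |
          ∃ A ⊆ Prod.mk i ⁻¹' R, A.Infinite ∧ ‖B.proj A (U i (B.vec (s j)))‖ ≤ ε / 2}) => hm.2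
      set P := {i ∈ {m | (Prod.mk m ⁻¹' R).Infinite} \ (F : Set ℕ) |
          ∃ A ⊆ Prod.mk i ⁻¹' R, A.Infinite ∧ ‖B.proj A (U i (B.vec (s j)))‖ ≤ ε / 2} with hPdef
      have hrow : ∀ m ∈ P, Prod.mk m ⁻¹' {q : ℕ × ℕ | q.1 ∈ P ∧ q.2 ∈ A q.1} = A m :=
        fun m hm => by ext i; exact and_iff_right hm
      have hrow' : ∀ m ∉ P, Prod.mk m ⁻¹' {q : ℕ × ℕ | q.1 ∈ P ∧ q.2 ∈ A q.1} = ∅ :=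
        fun m hm => by ext i; exact iff_of_false (fun h => hm h.1) (Set.notMem_empty i)
      refine ⟨j, {q | q.1 ∈ P ∧ q.2 ∈ A q.1}, fun q hq => hA q.1 hq.1 hq.2,
        fun q hq h => hq.1.1.2 (Finset.mem_coe.2 h), hj.mono fun m hm => ?_, ?_⟩
      · rw [Set.mem_ofPred_eq, hrow m hm]; exact hAi m hm
      · refine lp.norm_le_of_forall_le (half_pos hε).le fun m => ?_
        rw [lpProj_apply]
        by_cases hm : m ∈ P
        · rw [hrow m hm]; exact hAn m hm
        · rw [hrow' m hm, proj_empty]; simpa using (half_pos hε).le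
    · set v := H (B.lpVec p (n, s 0)) with hv
      have hd : 0 < ε / 2 / (B.K + 1) := by positivity
      obtain ⟨t, ht⟩ := ((lp.hasSum_single hp v).eventually
        (Metric.ball_mem_nhds v hd)).exists
      set P := {m | (Prod.mk m ⁻¹' R).Infinite} \ ((F ∪ t : Finset ℕ) : Set ℕ) with hPdef
      refine ⟨0, R ∩ {q | q.1 ∈ P}, Set.inter_subset_left, fun q hq h => hq.2.2 (by simp [h]),
        (hR.infinite_rows.sdiff (F ∪ t).finite_toSet).mono fun m hm => ?_, ?_⟩
      · have : Prod.mk m ⁻¹' (R ∩ {q | q.1 ∈ P}) = Prod.mk m ⁻¹' R := by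
          ext i; exact and_iff_left hm
        rw [Set.mem_ofPred_eq, this]; exact hm.1
      · have h0 : B.lpProj p (R ∩ {q | q.1 ∈ P}) (∑ m ∈ t, lp.single p m (v m)) = 0 := by
          rw [map_sum]
          refine Finset.sum_eq_zero fun m hm => B.lp_ext fun q => ?_
          rw [lpCoord_lpProj, map_zero]
          split_ifs with hq
          · rw [lpCoord_apply, lp.single_apply_ne, map_zero]
            rintro rfl
            exact hq.2.2 (by simp [hm])
          · rfl
        have h1 : B.lpProj p (R ∩ {q | q.1 ∈ P}) v =
            B.lpProj p (R ∩ {q | q.1 ∈ P}) (v - ∑ m ∈ t, lp.single p m (v m)) := by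
          rw [map_sub, h0, sub_zero]
        rw [h1]
        have ht' : ‖v - ∑ m ∈ t, lp.single p m (v m)‖ ≤ ε / 2 / (B.K + 1) := by
          rw [← dist_eq_norm, dist_comm]; exact (Metric.mem_ball.1 ht).le
        calc _ ≤ B.K * ‖v - ∑ m ∈ t, lp.single p m (v m)‖ := B.norm_lpProj_apply_le _ _
          _ ≤ (B.K + 1) * (ε / 2 / (B.K + 1)) :=
            mul_le_mul (by linarith) ht' (norm_nonneg _) (by positivity)
          _ = ε / 2 := by field_simp
  choose! A hA hAi hAn using hs2 j
  refine ⟨s j, hs1 j, replaceRows F A R₀, replaceRows_subset hA hR₀,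
    isLarge_replaceRows hAi hR₀i, ?_⟩
  rw [B.lpProj_replaceRows F A hR₀F]
  have h1 : ‖∑ m ∈ F, lp.single p m (B.proj (A m) (H (B.lpVec p (n, s j)) m))‖ ≤ ε / 2 := by
    calc _ ≤ ∑ _m ∈ F, η := norm_sum_le_of_le F fun m hm => by
          rw [lp.norm_single (pos_iff_ne_zero.2 hp0)]; exact hAn m hm
      _ = F.card * η := by simp
      _ ≤ (F.card + 1) * η := by gcongr; linarith
      _ = ε / 2 := by rw [hη]; field_simp
  exact (norm_add_le_of_le h1 hR₀n).trans (add_halves ε).le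

end SubsymmetricSystem

/-! ### Selection of an almost diagonal submatrix and of a complemented copy. -/

theorem IsLarge.sdiff_singleton {F : Finset ℕ} {R : Set (ℕ × ℕ)} (h : IsLarge F R) (q : ℕ × ℕ) :
    IsLarge F (R \ {q}) := by
  have key : ∀ m, (Prod.mk m ⁻¹' R).Infinite → (Prod.mk m ⁻¹' (R \ {q})).Infinite := fun m hm =>
    (hm.sdiff (Set.finite_singleton q.2)).mono fun i hi =>
      ⟨hi.1, fun h => hi.2 (by rw [Set.mem_singleton_iff] at h ⊢; rw [← h])⟩
  exact ⟨fun m hm => key m (h.infinite_row m hm), h.infinite_rows.mono fun m hm => key m hm⟩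

theorem IsLarge.exists_insert {F : Finset ℕ} {R : Set (ℕ × ℕ)} (h : IsLarge F R) :
    ∃ m ∉ F, IsLarge (insert m F) R := by
  obtain ⟨m, hm, hmF⟩ := h.infinite_rows.exists_notMem_finset F
  refine ⟨m, hmF, fun n hn => ?_, h.infinite_rows⟩
  rcases Finset.mem_insert.1 hn with rfl | hn
  · exact hm
  · exact h.infinite_row n hn

namespace SubsymmetricSystem

variable {𝕜 E : Type*} [RCLike 𝕜] [NormedAddCommGroup E] [NormedSpace 𝕜 E]
  (B : SubsymmetricSystem 𝕜 E) {p : ℝ≥0∞} [Fact (1 ≤ p)]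

/-- The column is made small first, then the index is removed and the row functional is made small
on a further subset. Shrinking can enlarge the column by a factor `K`, whence the tolerance `ε / (K
+ 1)` in the first choice. -/
theorem exists_isLarge_step [CompleteSpace E]
    (H : lp (fun _ : ℕ => E) p →L[𝕜] lp (fun _ : ℕ => E) p) {F : Finset ℕ}
    {R : Set (ℕ × ℕ)} (hR : IsLarge F R) {n : ℕ} (hn : n ∈ F) {ε : ℝ} (hε : 0 < ε) :
    ∃ q ∈ R, q.1 = n ∧ ∃ R' ⊆ R, q ∉ R' ∧ IsLarge F R' ∧
      ‖(B.lpCoord p q ∘L H) ∘L B.lpProj p R'‖ ≤ ε ∧ ‖B.lpProj p R' (H (B.lpVec p q))‖ ≤ ε := by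
  have hK := B.K_nonneg
  obtain ⟨j, hj, R₁, hR₁, hR₁l, hR₁n⟩ :=
    B.exists_isLarge_norm_lpProj_apply_le H hR hn (ε := ε / (B.K + 1)) (by positivity)
  obtain ⟨R₂, hR₂, hR₂l, hR₂n⟩ := B.exists_isLarge_norm_comp_le (B.lpCoord p (n, j) ∘L H)
    (hR₁l.sdiff_singleton (n, j)) hε
  refine ⟨(n, j), hj, rfl, R₂, fun q hq => hR₁ (hR₂ hq).1, fun h => (hR₂ h).2 rfl, hR₂l, hR₂n, ?_⟩
  have : R₂ ∩ R₁ = R₂ := Set.inter_eq_left.2 fun q hq => (hR₂ hq).1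
  rw [← this, ← lpProj_lpProj]
  calc _ ≤ B.K * ‖B.lpProj p R₁ (H (B.lpVec p (n, j)))‖ := B.norm_lpProj_apply_le _ _
    _ ≤ (B.K + 1) * (ε / (B.K + 1)) :=
      mul_le_mul (by linarith) hR₁n (norm_nonneg _) (by positivity)
    _ = ε := by field_simp

/-- A sequence of index pairs along which the matrix of `H` is almost diagonal. -/
theorem exists_almost_diagonal [CompleteSpace E]
    (H : lp (fun _ : ℕ => E) p →L[𝕜] lp (fun _ : ℕ => E) p) {R : Set (ℕ × ℕ)}
    (hR : IsLarge ∅ R) {δ : ℕ → ℝ} (hδ : ∀ k, 0 < δ k) :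
    ∃ (γ : ℕ → ℕ × ℕ) (c : ℕ → ℕ) (Q : ℕ → Set (ℕ × ℕ)), Function.Injective c ∧
      (∀ k, γ k ∈ R) ∧ (∀ k, (γ k).1 = c k.unpair.1) ∧ (∀ k l, γ l ∈ Q k ↔ k < l) ∧
      ∀ k, ‖(B.lpCoord p (γ k) ∘L H) ∘L B.lpProj p (Q k)‖ ≤ δ k ∧
        ‖B.lpProj p (Q k) (H (B.lpVec p (γ k)))‖ ≤ δ k := by
  classical
  -- The state after `k` steps consists of the rows `c 0, ..., c (k - 1)` reserved so far and of the
  -- current large set, whose reserved rows are still infinite.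
  let valid : ℕ → (ℕ → ℕ) × Set (ℕ × ℕ) → Prop := fun k s =>
    Set.InjOn s.1 (Set.Iio k) ∧ IsLarge ((Finset.range k).image s.1) s.2 ∧ s.2 ⊆ R
  have step : ∀ k (s : {s // valid k s}), ∃ (s' : {s // valid (k + 1) s}) (q : ℕ × ℕ),
      (∀ a < k, s'.1.1 a = s.1.1 a) ∧ s'.1.2 ⊆ s.1.2 ∧ q ∈ s.1.2 ∧ q ∉ s'.1.2 ∧
      q.1 = s'.1.1 k.unpair.1 ∧ ‖(B.lpCoord p q ∘L H) ∘L B.lpProj p s'.1.2‖ ≤ δ k ∧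
      ‖B.lpProj p s'.1.2 (H (B.lpVec p q))‖ ≤ δ k := by
    rintro k ⟨⟨c, Q⟩, hinj, hl, hQR⟩
    simp only at hinj hl hQR
    -- A new row is reserved as `c k` before the pair is picked. Since `k.unpair.1 ≤ k`, the row
    -- wanted at step `k` is then available, and the unpairing visits every reserved row infinitely
    -- often.
    obtain ⟨m, hm, hml⟩ := hl.exists_insert
    set c' := Function.update c k m with hc'
    have hcc : ∀ a < k, c' a = c a := fun a ha => Function.update_of_ne ha.ne _ _
    have hck : c' k = m := Function.update_self _ _ _
    have himg : (Finset.range (k + 1)).image c' = insert m ((Finset.range k).image c) := by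
      rw [Finset.range_add_one, Finset.image_insert, hck]
      congr 1
      exact Finset.image_congr fun a ha => hcc a (Finset.mem_range.1 (Finset.mem_coe.1 ha))
    have hne : ∀ a < k, c a ≠ m := fun a ha h =>
      hm (Finset.mem_image.2 ⟨a, Finset.mem_range.2 ha, h⟩)
    have hinj' : Set.InjOn c' (Set.Iio (k + 1)) := by
      intro a ha b hb hab
      rcases (Nat.lt_succ_iff_lt_or_eq.1 ha) with ha | rfl <;>
        rcases (Nat.lt_succ_iff_lt_or_eq.1 hb) with hb | rfl
      · rw [hcc a ha, hcc b hb] at hab; exact hinj ha hb hab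
      · rw [hcc a ha, hck] at hab; exact absurd hab (hne a ha)
      · rw [hcc b hb, hck] at hab; exact absurd hab.symm (hne b hb)
      · rfl
    have hmem : c' k.unpair.1 ∈ insert m ((Finset.range k).image c) := by
      rw [← himg]
      exact Finset.mem_image_of_mem _ (Finset.mem_range.2 (Nat.lt_succ_of_le (Nat.unpair_left_le k)))
    obtain ⟨q, hq, hqn, Q', hQ', hqQ', hl', h1, h2⟩ := B.exists_isLarge_step H hml hmem (hδ k)
    exact ⟨⟨⟨c', Q'⟩, hinj', himg ▸ hl', hQ'.trans hQR⟩, q, hcc, hQ', hq, hqQ', hqn, h1, h2⟩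
  choose next q hnext using step
  let seq : ∀ k, {s // valid k s} := fun k =>
    Nat.rec (motive := fun k => {s // valid k s})
      ⟨⟨id, R⟩, by simp [Set.InjOn], by simpa using hR, subset_rfl⟩ (fun k s => next k s) k
  have hseq : ∀ k, seq (k + 1) = next k (seq k) := fun k => rfl
  have hanti : Antitone fun k => (seq k).1.2 := antitone_nat_of_succ_le fun k => by
    rw [hseq]; exact (hnext k (seq k)).2.1
  have hc : ∀ a k, (seq (a + 1 + k)).1.1 a = (seq (a + 1)).1.1 a := fun a k => by
    induction k with
    | zero => rfl
    | succ k ih =>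
      rw [← ih, ← Nat.add_assoc, hseq]
      exact (hnext _ _).1 a (by omega)
  have hc' : ∀ a k, a < k → (seq k).1.1 a = (seq (a + 1)).1.1 a := fun a k h => by
    obtain ⟨d, rfl⟩ := Nat.exists_eq_add_of_le (Nat.succ_le_of_lt h)
    exact hc a d
  refine ⟨fun k => q k (seq k), fun a => (seq (a + 1)).1.1 a, fun k => (seq (k + 1)).1.2,
    ?_, fun k => (seq k).2.2.2 (hnext k (seq k)).2.2.1, fun k => ?_, fun k l => ⟨fun h => ?_,
    fun h => hanti (Nat.succ_le_of_lt h) (hnext l (seq l)).2.2.1⟩, fun k => ?_⟩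
  · intro a b hab
    simp only at hab
    rw [← hc' a (max a b + 1) (by omega), ← hc' b (max a b + 1) (by omega)] at hab
    exact (seq (max a b + 1)).2.1 (by simp) (by simp) hab
  · simp only
    rw [(hnext k (seq k)).2.2.2.2.1, ← hc' k.unpair.1 (k + 1)
      (Nat.lt_succ_of_le (Nat.unpair_left_le k)), hseq]
  · by_contra hlk
    exact (hnext l (seq l)).2.2.2.1 (hanti (Nat.succ_le_succ (not_lt.1 hlk)) h)
  · exact (hnext k (seq k)).2.2.2.2.2

theorem exists_lpMul (p : ℝ≥0∞) [Fact (1 ≤ p)] {g : ℕ × ℕ → 𝕜} {C : ℝ} (hC : 0 < C)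
    (hg : ∀ q, ‖g q‖ ≤ C) : ∃ D : lp (fun _ : ℕ => E) p →L[𝕜] lp (fun _ : ℕ => E) p,
      ‖D‖ ≤ C * B.K ∧ ∀ q y, B.lpCoord p q (D y) = g q * B.lpCoord p q y := by
  have hC' : (C : 𝕜) ≠ 0 := by exact_mod_cast hC.ne'
  have h1 : ∀ m i, ‖g (m, i) / (C : 𝕜)‖ ≤ 1 := fun m i => by
    rw [norm_div, RCLike.norm_ofReal, abs_of_pos hC]
    exact div_le_one_of_le₀ (hg _) hC.le
  obtain ⟨D, hD, hDy⟩ := lp_exists_op p (id : ℕ → ℕ)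
    (fun m => (C : 𝕜) • B.mul fun i => g (m, i) / (C : 𝕜)) Function.injective_id.injOn
    (mul_nonneg hC.le B.K_nonneg) fun m => by
      rw [norm_smul, RCLike.norm_ofReal, abs_of_pos hC]
      exact mul_le_mul_of_nonneg_left (B.norm_mul_le _ (h1 m)) hC.le
  refine ⟨D, hD, fun q y => ?_⟩
  rw [lpCoord_apply, hDy, smul_apply, map_smul, B.coord_mul _ (h1 q.1),
    lpCoord_apply, smul_eq_mul, ← mul_assoc, mul_div_cancel₀ _ hC']
  rfl

/-- The elements of `ℓᵖ(E)` supported in a set with infinitely many infinite rows form a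
complemented copy of `ℓᵖ(E)`. -/
theorem exists_lp_spread (p : ℝ≥0∞) [Fact (1 ≤ p)] {c : ℕ → ℕ} (hc : Function.Injective c)
    {G : Set (ℕ × ℕ)} (hGi : ∀ a, (Prod.mk (c a) ⁻¹' G).Infinite) :
    ∃ J J' : lp (fun _ : ℕ => E) p →L[𝕜] lp (fun _ : ℕ => E) p, ‖J‖ ≤ B.L ∧ ‖J'‖ ≤ B.K * B.L ∧
      (∀ y, J' (J y) = y) ∧ (∀ q ∉ G, ∀ y, B.lpCoord p q (J y) = 0) ∧
      ∀ z, (∀ q ∈ G, B.lpCoord p q z = 0) → J' z = 0 := by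
  classical
  choose n hn hnr using fun a => (hGi a).exists_strictMono_range
  choose S T hS hT hS1 hS2 hT1 using fun a => B.exists_spread (n a) (hn a)
  -- `J` spreads row `a` along the infinite row `c a` of `G`, and `J'` reads it back; rows outside
  -- the range of `c` receive zero.
  set σ := Function.invFun c
  have hσ : ∀ a, σ (c a) = a := Function.leftInverse_invFun hc
  obtain ⟨J, hJ, hJy⟩ := lp_exists_op p σ (fun m => if m ∈ Set.range c then S (σ m) else 0)
    (fun a ha b hb hab => by
      have ha' : a ∈ Set.range c := by by_contra h; exact ha (if_neg h)
      have hb' : b ∈ Set.range c := by by_contra h; exact hb (if_neg h)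
      obtain ⟨a, rfl⟩ := ha'
      obtain ⟨b, rfl⟩ := hb'
      rw [hσ, hσ] at hab; rw [hab])
    B.L_nonneg (fun m => by
      split_ifs
      · exact hS _
      · simpa using B.L_nonneg)
  obtain ⟨J', hJ', hJy'⟩ := lp_exists_op p c T hc.injOn
    (mul_nonneg B.K_nonneg B.L_nonneg) hT
  refine ⟨J, J', hJ, hJ', fun y => B.lp_ext fun q => ?_, fun q hq y => ?_,
    fun z hz => B.lp_ext fun q => ?_⟩
  · rw [lpCoord_apply, hJy', hT1, hJy, if_pos ⟨_, rfl⟩, hσ, hS1]; rfl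
  · rw [lpCoord_apply, hJy]
    split_ifs with h
    · obtain ⟨a, ha⟩ := h
      rw [← ha, hσ]
      refine hS2 a _ (fun h => hq ?_) _
      rw [hnr a, ha] at h
      exact h
    · simp
  · rw [lpCoord_apply, hJy', hT1, map_zero]
    exact hz (c q.1, n q.1 q.2) ((hnr q.1).subset ⟨q.2, rfl⟩)

end SubsymmetricSystem

/-! ### Inversion and factorization of the identity. -/

/-- This is the Neumann series for `1 - U`; the bound 2 comes from `‖V z‖ ≤ ‖z‖ + ‖V z‖ / 2`. -/
theorem ContinuousLinearMap.exists_leftInverse_of_norm_sub_le {𝕜 X : Type*} [RCLike 𝕜]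
    [NormedAddCommGroup X] [NormedSpace 𝕜 X] [CompleteSpace X] (U : X →L[𝕜] X)
    (hU : ∀ y, ‖U y - y‖ ≤ 1 / 2 * ‖y‖) :
    ∃ V : X →L[𝕜] X, ‖V‖ ≤ 2 ∧ ∀ y, V (U y) = y := by
  set t : X →L[𝕜] X := 1 - U with ht
  have ht1 : ‖t‖ < 1 := by
    refine lt_of_le_of_lt (ContinuousLinearMap.opNorm_le_bound _ (by norm_num : (0:ℝ) ≤ 1 / 2)
      fun y => ?_) (by norm_num)
    have : t y = -(U y - y) := by simp [ht]
    rw [this, norm_neg]; exact hU y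
  set u := Units.oneSub t ht1 with hu
  have huU : (u : X →L[𝕜] X) = U := by simp [hu, ht]
  have h1 : ∀ y, (↑u⁻¹ : X →L[𝕜] X) (U y) = y := fun y => by
    rw [← huU, ← mul_apply_eq_comp, Units.inv_mul, one_apply_eq_self]
  have h2 : ∀ y, U ((↑u⁻¹ : X →L[𝕜] X) y) = y := fun y => by
    rw [← huU, ← mul_apply_eq_comp, Units.mul_inv, one_apply_eq_self]
  refine ⟨↑u⁻¹, ContinuousLinearMap.opNorm_le_bound _ zero_le_two fun z => ?_, h1⟩
  have h3 := hU ((↑u⁻¹ : X →L[𝕜] X) z)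
  rw [h2] at h3
  have h4 := norm_le_norm_add_norm_sub' ((↑u⁻¹ : X →L[𝕜] X) z) z
  rw [norm_sub_rev] at h4
  linarith

namespace SubsymmetricSystem

variable {𝕜 E : Type*} [RCLike 𝕜] [NormedAddCommGroup E] [NormedSpace 𝕜 E]
  (B : SubsymmetricSystem 𝕜 E) {p : ℝ≥0∞} [Fact (1 ≤ p)]

/-- If the diagonal of `H` is bounded below on a large set, then the identity factors through
`H`. -/
theorem exists_factorization_of_isLarge [CompleteSpace E]
    (H : lp (fun _ : ℕ => E) p →L[𝕜] lp (fun _ : ℕ => E) p)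
    (hH : IsLarge ∅ {q | 1 / 2 ≤ ‖B.lpCoord p q (H (B.lpVec p q))‖}) :
    ∃ M N : lp (fun _ : ℕ => E) p →L[𝕜] lp (fun _ : ℕ => E) p,
      N ∘L H ∘L M = ContinuousLinearMap.id 𝕜 _ ∧ ‖M‖ * ‖N‖ ≤ 4 * B.K ^ 2 * B.L ^ 2 := by
  classical
  have hK := B.K_nonneg
  have hL := B.L_nonneg
  -- The error below is `(K L) (2 K) (2 δ) L = 4 K² L² δ`, which this choice keeps at most 1/2.
  set δ : ℝ := 1 / (8 * B.K ^ 2 * B.L ^ 2 + 1) with hδ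
  have hδ0 : 0 < δ := by positivity
  have hgeo := hasSum_geometric_two' δ
  obtain ⟨γ, c, Q, hc, hγR, hγc, hγQ, hγ⟩ := B.exists_almost_diagonal H hH
    (δ := fun k => δ / 2 / 2 ^ k) fun k => by positivity
  have hγinj : Function.Injective γ := fun k l hkl => by
    by_contra hne
    rcases lt_or_gt_of_ne hne with h | h
    · exact absurd ((hγQ k k).1 (hkl ▸ (hγQ k l).2 h)) (lt_irrefl k)
    · exact absurd ((hγQ l l).1 (hkl ▸ (hγQ l k).2 h)) (lt_irrefl l)
  obtain ⟨J, J', hJ, hJ', hJJ, hJ0, hJ'0⟩ := B.exists_lp_spread p hc (G := Set.range γ) fun a => by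
    refine (Set.infinite_range_of_injective (f := fun b => (γ (Nat.pair a b)).2)
      fun b b' h => ?_).mono ?_
    · have : γ (Nat.pair a b) = γ (Nat.pair a b') := Prod.ext (by simp [hγc]) h
      exact (Nat.pair_eq_pair.1 (hγinj this)).2
    · rintro _ ⟨b, rfl⟩
      exact ⟨Nat.pair a b, Prod.ext (by simp [hγc]) rfl⟩
  set d : ℕ × ℕ → 𝕜 := fun q => B.lpCoord p q (H (B.lpVec p q)) with hd
  -- `D` inverts the diagonal on the selected pairs; the entries are at least 1/2 in modulus, so the
  -- inverses are at most 2.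
  obtain ⟨D, hD, hDy⟩ := B.exists_lpMul p (g := fun q => if q ∈ Set.range γ then (d q)⁻¹ else 0)
    two_pos fun q => by
      split_ifs with h
      · obtain ⟨k, rfl⟩ := h
        have h2 : 1 / 2 ≤ ‖d (γ k)‖ := hγR k
        rw [norm_inv, inv_le_comm₀ (by linarith) two_pos]
        linarith
      · simp
  have hd0 : ∀ k, d (γ k) ≠ 0 := fun k => norm_pos_iff.1 (one_half_pos.trans_le (hγR k))
  have main : ∀ y, ‖J' (D (H (J y))) - y‖ ≤ 1 / 2 * ‖y‖ := fun y => by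
    set x := J y with hx
    have hx0 : ∀ q ∉ Set.range γ, B.lpCoord p q x = 0 := fun q hq => hJ0 q hq y
    set f : ℕ → lp (fun _ : ℕ => E) p := fun l =>
      B.lpCoord p (γ l) x • B.lpProj p (Q l) (H (B.lpVec p (γ l))) with hf
    set g : ℕ → lp (fun _ : ℕ => E) p := fun k =>
      B.lpCoord p (γ k) (H (B.lpProj p (Q k) x)) • B.lpVec p (γ k) with hg
    have hfn : ∀ l, ‖f l‖ ≤ δ / 2 / 2 ^ l * ‖x‖ := fun l => by
      rw [hf, norm_smul, mul_comm]
      exact mul_le_mul (hγ l).2 (B.norm_lpCoord_apply_le _ _) (norm_nonneg _) (by positivity)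
    have hgn : ∀ k, ‖g k‖ ≤ δ / 2 / 2 ^ k * ‖x‖ := fun k => by
      rw [hg, norm_smul]
      exact (mul_le_of_le_one_right (norm_nonneg _) (B.norm_lpVec_le _)).trans
        (ContinuousLinearMap.le_of_opNorm_le _ (hγ k).1 x)
    have hfs : Summable f := Summable.of_norm_bounded (hgeo.mul_right _).summable hfn
    have hgs : Summable g := Summable.of_norm_bounded (hgeo.mul_right _).summable hgn
    -- The two series collect the off-diagonal action of `H` on `x`: `f` the contributions of
    -- earlier pairs to later coordinates, `g` those of later pairs to earlier coordinates.
    set w := ∑' l, f l + ∑' k, g k with hw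
    have hwn : ‖w‖ ≤ 2 * δ * ‖x‖ := by
      refine (norm_add_le_of_le (tsum_of_norm_bounded (hgeo.mul_right _) hfn)
        (tsum_of_norm_bounded (hgeo.mul_right _) hgn)).trans (le_of_eq (by ring))
    have hwk : ∀ k, B.lpCoord p (γ k) w =
        B.lpCoord p (γ k) (H x) - d (γ k) * B.lpCoord p (γ k) x := fun k => by
      -- A full expansion of `x` need not converge in norm. Only finitely many terms are split off,
      -- and the rest of `x` is supported in `Q k`.
      have hx' : x = ∑ l ∈ Finset.range (k + 1), B.lpCoord p (γ l) x • B.lpVec p (γ l) +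
          B.lpProj p (Q k) x := by
        refine B.lp_ext fun q => ?_
        rw [map_add, map_sum, lpCoord_lpProj]
        simp only [map_smul, lpCoord_lpVec]
        by_cases hq : q ∈ Set.range γ
        · obtain ⟨l, rfl⟩ := hq
          simp only [hγinj.eq_iff, hγQ, smul_eq_mul, mul_ite, mul_one, mul_zero,
            Finset.sum_ite_eq, Finset.mem_range]
          split_ifs with h1 h2 h2
          · omega
          · simp
          · simp
          · omega
        · rw [hx0 q hq, Finset.sum_eq_zero]
          · simp
          · intro l _
            rw [if_neg fun h => hq ⟨l, h.symm⟩, smul_zero]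
      have hgk : B.lpCoord p (γ k) (∑' l, g l) = B.lpCoord p (γ k) (H (B.lpProj p (Q k) x)) := by
        rw [(B.lpCoord p (γ k)).map_tsum hgs, tsum_eq_single k]
        · simp [hg, lpCoord_lpVec]
        · intro l hl
          simp [hg, lpCoord_lpVec, hγinj.eq_iff, hl.symm]
      have hfk : B.lpCoord p (γ k) (∑' l, f l) = ∑ l ∈ Finset.range k,
          B.lpCoord p (γ l) x * B.lpCoord p (γ k) (H (B.lpVec p (γ l))) := by
        rw [(B.lpCoord p (γ k)).map_tsum hfs, tsum_eq_sum (s := Finset.range k)]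
        · refine Finset.sum_congr rfl fun l hl => ?_
          rw [hf, map_smul, lpCoord_lpProj, if_pos ((hγQ l k).2 (Finset.mem_range.1 hl)),
            smul_eq_mul]
        · intro l hl
          rw [hf, map_smul, lpCoord_lpProj, if_neg fun h => hl (Finset.mem_range.2
            ((hγQ l k).1 h)), smul_zero]
      have hHx : B.lpCoord p (γ k) (H x) = ∑ l ∈ Finset.range (k + 1),
          B.lpCoord p (γ l) x * B.lpCoord p (γ k) (H (B.lpVec p (γ l))) +
          B.lpCoord p (γ k) (H (B.lpProj p (Q k) x)) := by
        conv_lhs => rw [hx']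
        simp only [map_add, map_sum, map_smul, smul_eq_mul]
      rw [hHx, hw, map_add, hgk, hfk, Finset.sum_range_succ]
      ring
    -- `J'` sees only the coordinates in the range of `γ`, and there `D (H x)` and `x + D w` agree.
    have hdiff : J' (D (H x)) - y = J' (D w) := by
      have h0 : J' (D (H x) - x - D w) = 0 := hJ'0 _ fun q hq => by
        rw [map_sub, map_sub, hDy, hDy, if_pos hq]
        obtain ⟨k, rfl⟩ := hq
        rw [hwk k]
        field_simp [hd0 k]
        ring
      rw [map_sub, map_sub, hx, hJJ, sub_eq_zero] at h0
      exact h0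
    have hxn : ‖x‖ ≤ B.L * ‖y‖ := J.le_of_opNorm_le hJ y
    rw [hdiff]
    calc ‖J' (D w)‖ ≤ (B.K * B.L) * ‖D w‖ := J'.le_of_opNorm_le hJ' _
      _ ≤ (B.K * B.L) * ((2 * B.K) * ‖w‖) :=
        mul_le_mul_of_nonneg_left (D.le_of_opNorm_le hD w) (by positivity)
      _ ≤ (B.K * B.L) * ((2 * B.K) * (2 * δ * (B.L * ‖y‖))) := by
        gcongr; exact hwn.trans (by gcongr)
      _ = 1 / 2 * (8 * B.K ^ 2 * B.L ^ 2 * δ) * ‖y‖ := by ring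
      _ ≤ 1 / 2 * 1 * ‖y‖ := by
        gcongr
        rw [hδ, mul_one_div]
        exact div_le_one_of_le₀ (by linarith) (by positivity)
      _ = 1 / 2 * ‖y‖ := by ring
  obtain ⟨V, hV, hVU⟩ := (J' ∘L D ∘L H ∘L J).exists_leftInverse_of_norm_sub_le main
  refine ⟨J, V ∘L J' ∘L D, ContinuousLinearMap.ext hVU, ?_⟩
  have hN : ‖V ∘L J' ∘L D‖ ≤ 2 * ((B.K * B.L) * (2 * B.K)) :=
    (ContinuousLinearMap.opNorm_comp_le _ _).trans <|
      mul_le_mul hV ((ContinuousLinearMap.opNorm_comp_le _ _).trans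
        (mul_le_mul hJ' hD (norm_nonneg _) (by positivity))) (norm_nonneg _) zero_le_two
  calc ‖J‖ * ‖V ∘L J' ∘L D‖ ≤ B.L * (2 * ((B.K * B.L) * (2 * B.K))) :=
        mul_le_mul hJ hN (norm_nonneg _) hL
    _ = 4 * B.K ^ 2 * B.L ^ 2 := by ring

/-- The diagonals of `T` and `Id - T` sum to 1. Pigeonhole within each row, and then among the rows,
makes one of them large on infinitely many infinite rows. -/
theorem exists_factorization [CompleteSpace E]
    (T : lp (fun _ : ℕ => E) p →L[𝕜] lp (fun _ : ℕ => E) p) :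
    ∃ H : lp (fun _ : ℕ => E) p →L[𝕜] lp (fun _ : ℕ => E) p,
      (H = T ∨ H = ContinuousLinearMap.id 𝕜 _ - T) ∧
      ∃ M N : lp (fun _ : ℕ => E) p →L[𝕜] lp (fun _ : ℕ => E) p,
        N ∘L H ∘L M = ContinuousLinearMap.id 𝕜 _ ∧ ‖M‖ * ‖N‖ ≤ 4 * B.K ^ 2 * B.L ^ 2 := by
  set R : (lp (fun _ : ℕ => E) p →L[𝕜] lp (fun _ : ℕ => E) p) → Set (ℕ × ℕ) :=
    fun H => {q | 1 / 2 ≤ ‖B.lpCoord p q (H (B.lpVec p q))‖} with hR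
  set T' := ContinuousLinearMap.id 𝕜 (lp (fun _ : ℕ => E) p) - T with hT'
  have hcover : ∀ q, q ∈ R T ∪ R T' := fun q => by
    by_contra h
    rw [Set.mem_union, not_or] at h
    have h1 : ‖B.lpCoord p q (T (B.lpVec p q))‖ < 1 / 2 := not_le.1 h.1
    have h2 : ‖B.lpCoord p q (T' (B.lpVec p q))‖ < 1 / 2 := not_le.1 h.2
    have h3 : B.lpCoord p q (T (B.lpVec p q)) + B.lpCoord p q (T' (B.lpVec p q)) = 1 := by
      simp [hT', lpCoord_lpVec]
    have h4 := norm_add_le (B.lpCoord p q (T (B.lpVec p q))) (B.lpCoord p q (T' (B.lpVec p q)))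
    rw [h3, norm_one] at h4
    linarith
  have hrows : ∀ m, (Prod.mk m ⁻¹' R T).Infinite ∨ (Prod.mk m ⁻¹' R T').Infinite := fun m => by
    rw [← Set.infinite_union]
    convert Set.infinite_univ (α := ℕ)
    exact Set.eq_univ_of_forall fun i => hcover (m, i)
  have hlarge : {m | (Prod.mk m ⁻¹' R T).Infinite}.Infinite ∨
      {m | (Prod.mk m ⁻¹' R T').Infinite}.Infinite := by
    rw [← Set.infinite_union]
    convert Set.infinite_univ (α := ℕ)
    exact Set.eq_univ_of_forall fun m => hrows m
  rcases hlarge with h | h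
  · exact ⟨T, Or.inl rfl, B.exists_factorization_of_isLarge T ⟨by simp, h⟩⟩
  · exact ⟨T', Or.inr rfl, B.exists_factorization_of_isLarge T' ⟨by simp, h⟩⟩

/-- `ℓᵖ(E)` is primary. -/
theorem isPrimary_lp [CompleteSpace E] (B : SubsymmetricSystem 𝕜 E) (p : ℝ≥0∞) [Fact (1 ≤ p)] :
    IsPrimary 𝕜 (lp (fun _ : ℕ => E) p) := fun Q hQ => by
  obtain ⟨H, rfl | rfl, M, N, h, -⟩ := B.exists_factorization Q
  · exact Or.inl (lp_nonempty_range_equiv H M N hQ h)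
  · refine Or.inr (lp_nonempty_range_equiv _ M N ?_ h)
    ext1 x
    have : Q (Q x) = Q x :=
      congrArg (fun f : lp (fun _ : ℕ => E) p →L[𝕜] lp (fun _ : ℕ => E) p => f x) hQ
    simp [this]

end SubsymmetricSystem

/-! ### A gliding hump principle for increasing sequences. -/

/-- Gluing of finite pieces of strictly increasing sequences. -/
theorem exists_strictMono_forall {P : ℕ → (ℕ → ℕ) → Prop}
    (h : ∀ k m c, ∃ n : ℕ → ℕ, StrictMono n ∧ c ≤ n m ∧ ∃ m' > m, ∀ n' : ℕ → ℕ, StrictMono n' →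
      (∀ j, m ≤ j → j < m' → n j = n' j) → P k n') :
    ∃ n : ℕ → ℕ, StrictMono n ∧ ∀ k, P k n := by
  have step : ∀ (k : ℕ) (s : {s : (ℕ → ℕ) × ℕ // StrictMono s.1}),
      ∃ s' : {s : (ℕ → ℕ) × ℕ // StrictMono s.1}, (∀ j < s.1.2, s'.1.1 j = s.1.1 j) ∧
        s.1.2 < s'.1.2 ∧ ∀ n' : ℕ → ℕ, StrictMono n' →
          (∀ j < s'.1.2, s'.1.1 j = n' j) → P k n' := by
    rintro k ⟨⟨g, m⟩, hg⟩
    -- Asking the new piece to start at or above `g m` keeps the glued sequence strictly increasing.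
    obtain ⟨n, hn, hgn, m', hm', hP⟩ := h k m (g m)
    refine ⟨⟨⟨fun j => if j < m then g j else n j, m'⟩, fun i j hij => ?_⟩, fun j hj => if_pos hj,
      hm', fun n' hn' hj => hP n' hn' fun j h1 h2 => ?_⟩
    · simp only
      split_ifs with h1 h2 h2
      · exact hg hij
      · exact (hg h1).trans_le (hgn.trans (hn.monotone (not_lt.1 h2)))
      · omega
      · exact hn hij
    · rw [← hj j h2]; exact (if_neg (not_lt.2 h1)).symm
  choose next hnext using step
  let seq : ℕ → {s : (ℕ → ℕ) × ℕ // StrictMono s.1} := fun k =>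
    Nat.rec (motive := fun _ => {s : (ℕ → ℕ) × ℕ // StrictMono s.1}) ⟨⟨id, 0⟩, strictMono_id⟩
      (fun k s => next k s) k
  have hseq : ∀ k, seq (k + 1) = next k (seq k) := fun k => rfl
  have hm : StrictMono fun k => (seq k).1.2 := strictMono_nat_of_lt_succ fun k => by
    rw [hseq]; exact (hnext k (seq k)).2.1
  have hstab : ∀ j k d, j < (seq k).1.2 → (seq (k + d)).1.1 j = (seq k).1.1 j := fun j k d hj => by
    induction d with
    | zero => rfl
    | succ d ih =>
      rw [← ih, ← Nat.add_assoc, hseq]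
      exact (hnext _ _).1 j (hj.trans_le (hm.monotone (Nat.le_add_right k d)))
  have hlt : ∀ j, j < (seq (j + 1)).1.2 := fun j => (Nat.lt_succ_self j).trans_le hm.le_apply
  have hlim : ∀ j k, j < (seq k).1.2 → (seq k).1.1 j = (seq (j + 1)).1.1 j := fun j k hj => by
    rw [← hstab j k (j + 1) hj, ← hstab j (j + 1) k (hlt j), Nat.add_comm]
  have hmono : StrictMono fun j => (seq (j + 1)).1.1 j := fun i j hij => by
    simp only
    rw [← hlim i (j + 1) (hij.trans (hlt j))]
    exact (seq (j + 1)).2 hij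
  refine ⟨_, hmono, fun k => (hnext k (seq k)).2.2 _ hmono fun j hj => ?_⟩
  rw [← hseq] at hj ⊢
  exact hlim j (k + 1) hj

/-- Gliding hump: if no constant serves all sequences, finite blocks violating ever larger constants
are placed one after another, giving a single sequence that violates `hbound`. Locality makes a
block depend only on its piece of the sequence, and shifting makes room for the next piece. -/
theorem exists_uniform_bound {𝕜 E : Type*} [RCLike 𝕜] [NormedAddCommGroup E] [NormedSpace 𝕜 E]
    (P : ℕ → E → E) (W₁ W₂ : (ℕ → ℕ) → E →L[𝕜] E) {K : ℝ}
    (hblock : ∀ n, StrictMono n → ∀ m m' y, ‖W₁ n (P m' y - P m y)‖ ≤ K * ‖W₁ n y‖)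
    (hinit : ∀ n, StrictMono n → ∀ m y, ‖W₂ n (P m y)‖ ≤ m * ‖W₁ n y‖)
    (hlsc : ∀ n, StrictMono n → ∀ y r, r < ‖W₂ n y‖ → ∀ᶠ m in atTop, r < ‖W₂ n (P m y)‖)
    (hloc : ∀ n, StrictMono n → ∀ n', StrictMono n' → ∀ m m', m ≤ m' →
      (∀ j, m ≤ j → j < m' → n j = n' j) → ∀ y, W₁ n (P m' y - P m y) = W₁ n' (P m' y - P m y) ∧
        W₂ n (P m' y - P m y) = W₂ n' (P m' y - P m y))
    (hbound : ∀ n, StrictMono n → ∃ c, ∀ y, ‖W₂ n y‖ ≤ c * ‖W₁ n y‖)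
    (hshift : ∀ d, ∃ c > 0, ∀ n, StrictMono n → ∀ y, ‖W₁ (fun j => n j + d) y‖ ≤ c * ‖W₁ n y‖ ∧
      ‖W₂ n y‖ ≤ c * ‖W₂ (fun j => n j + d) y‖) :
    ∃ D, ∀ n, StrictMono n → ∀ y, ‖W₂ n y‖ ≤ D * ‖W₁ n y‖ := by
  by_contra! hD
  obtain ⟨n, hn, hP⟩ := exists_strictMono_forall
    (P := fun k n => ∃ y, k * ‖W₁ n y‖ < ‖W₂ n y‖) fun k m d => by
      obtain ⟨c, hc, hcn⟩ := hshift d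
      -- The summand `m` pays for removing the initial segment, `K` for passing to the block, and
      -- the two factors `c` for shifting `W₁` and `W₂`.
      obtain ⟨n, hn, y, hy⟩ := hD (m + c * (c * (K * k)))
      obtain ⟨m', hm'y, hm'⟩ := ((hlsc n hn y _ hy).and (eventually_gt_atTop m)).exists
      have hn' : StrictMono fun j => n j + d := hn.add_const d
      refine ⟨fun j => n j + d, hn', Nat.le_add_left _ _, m', hm', fun n' hn'' hj =>
        ⟨P m' y - P m y, ?_⟩⟩
      obtain ⟨h1, h2⟩ := hloc _ hn' n' hn'' m m' hm'.le hj y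
      rw [← h1, ← h2]
      obtain ⟨h3, h4⟩ := hcn n hn (P m' y - P m y)
      have h5 := hblock n hn m m' y
      have h6 := hinit n hn m y
      have h7 : ‖W₂ n (P m' y)‖ ≤ ‖W₂ n (P m' y - P m y)‖ + ‖W₂ n (P m y)‖ := by
        rw [map_sub]; exact norm_le_norm_sub_add _ _
      have h8 : c * (k * ‖W₁ (fun j => n j + d) (P m' y - P m y)‖) ≤
          c * (c * (K * k)) * ‖W₁ n y‖ := by
        calc _ ≤ c * (k * (c * (K * ‖W₁ n y‖))) := by
              gcongr; exact h3.trans (by gcongr)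
          _ = _ := by ring
      refine lt_of_mul_lt_mul_left ?_ hc.le
      linarith
  obtain ⟨c, hc⟩ := hbound n hn
  obtain ⟨k, hk⟩ := exists_nat_ge c
  obtain ⟨y, hy⟩ := hP k
  exact absurd (hc y) (not_le.2 (lt_of_le_of_lt (by gcongr) hy))

/-! ### Norm bounds for isomorphisms onto subspaces. -/

section IsoNorms

variable {𝕜 E : Type*} [RCLike 𝕜] [NormedAddCommGroup E] [NormedSpace 𝕜 E] {Y : Submodule 𝕜 E}

theorem bounds_of_isoNorms_le (Φ : E ≃L[𝕜] Y) {c : ℝ} (h : ∀ r ∈ isoNorms Φ, r ≤ c) (y : E) :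
    ‖Φ y‖ ≤ c * ‖y‖ ∧ ‖y‖ ≤ c * ‖Φ y‖ := by
  refine ⟨(Φ : E →L[𝕜] Y).le_of_opNorm_le (h _ (Or.inl rfl)) y, ?_⟩
  simpa using (Φ.symm : Y →L[𝕜] E).le_of_opNorm_le (h _ (Or.inr rfl)) (Φ y)

theorem exists_bounds_of_equiv (Φ : E ≃L[𝕜] Y) :
    ∃ c > 0, ∀ y, ‖Φ y‖ ≤ c * ‖y‖ ∧ ‖y‖ ≤ c * ‖Φ y‖ := by
  have h1 := norm_nonneg (Φ : E →L[𝕜] Y)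
  have h2 := norm_nonneg (Φ.symm : Y →L[𝕜] E)
  refine ⟨‖(Φ : E →L[𝕜] Y)‖ + ‖(Φ.symm : Y →L[𝕜] E)‖ + 1, by positivity,
    bounds_of_isoNorms_le Φ ?_⟩
  rintro r (rfl | rfl) <;> linarith

theorem isoNorms_le_of_bounds (Φ : E ≃L[𝕜] Y) {c : ℝ}
    (h : ∀ y, ‖Φ y‖ ≤ c * ‖y‖ ∧ ‖y‖ ≤ c * ‖Φ y‖) : ∀ r ∈ isoNorms Φ, r ≤ max c 0 := by
  rintro r (rfl | rfl)
  · refine ContinuousLinearMap.opNorm_le_bound _ (le_max_right _ _) fun y => (h y).1.trans ?_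
    exact mul_le_mul_of_nonneg_right (le_max_left _ _) (norm_nonneg _)
  · refine ContinuousLinearMap.opNorm_le_bound _ (le_max_right _ _) fun y => ?_
    refine (h (Φ.symm y)).2.trans ?_
    rw [Φ.apply_symm_apply]
    exact mul_le_mul_of_nonneg_right (le_max_left _ _) (norm_nonneg _)

/-- The inverse of `Φ` lives only on `Y`; composing it with an operator `D` into `Y` makes it
defined everywhere, at the cost of the norm of `D`. -/
theorem exists_ops_of_isoNorms_le (Φ : E ≃L[𝕜] Y) {c : ℝ} (h : ∀ r ∈ isoNorms Φ, r ≤ c)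
    {D : E →L[𝕜] E} (hD : ∀ y, D y ∈ Y) {C : ℝ} (hDC : ‖D‖ ≤ C) : ∃ S T : E →L[𝕜] E,
      ‖S‖ ≤ c ∧ ‖T‖ ≤ C * c ∧ (∀ y, S y = Φ y) ∧ ∀ y, (Φ (T y) : E) = D y := by
  have hc : 0 ≤ c := (norm_nonneg _).trans (h _ (Or.inl rfl))
  have hC : 0 ≤ C := (norm_nonneg _).trans hDC
  refine ⟨Y.subtypeL ∘L (Φ : E →L[𝕜] Y), (Φ.symm : Y →L[𝕜] E) ∘L D.codRestrict Y hD,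
    ContinuousLinearMap.opNorm_le_bound _ hc fun y => (bounds_of_isoNorms_le Φ h y).1,
    ContinuousLinearMap.opNorm_le_bound _ (by positivity) fun y => ?_, fun y => rfl,
    fun y => by simp⟩
  have h1 := (Φ.symm : Y →L[𝕜] E).le_of_opNorm_le (h _ (Or.inr rfl)) (D.codRestrict Y hD y)
  have h2 : ‖D.codRestrict Y hD y‖ ≤ C * ‖y‖ := D.le_of_opNorm_le hDC y
  calc _ ≤ c * ‖D.codRestrict Y hD y‖ := h1
    _ ≤ c * (C * ‖y‖) := by gcongr
    _ = C * c * ‖y‖ := by ring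

theorem exists_op_of_equiv (Φ : E ≃L[𝕜] Y) : ∃ U : E →L[𝕜] E, ∀ y, U y = Φ y :=
  ⟨Y.subtypeL ∘L (Φ : E →L[𝕜] Y), fun _ => rfl⟩

end IsoNorms

/-! ### The weak* basis of the dual and its subsequence maps. -/

namespace WeakStarBasis

variable {𝕜 S : Type*} [RCLike 𝕜] [NormedAddCommGroup S] [NormedSpace 𝕜 S]
  (b : SchauderBasis 𝕜 S)

theorem coord_basis (i j : ℕ) : b.coord i (b j) = if i = j then 1 else 0 := by
  refine (b.ortho i j).trans ?_
  split_ifs with h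
  · subst h; simp [Pi.single, Function.update]
  · simp [Pi.single, Function.update, h]

theorem hasWeakStarSum_coord (y : StrongDual 𝕜 S) :
    HasWeakStarSum (fun j => y (b j) • b.coord j) y := fun x => by
  have := (y.continuous.tendsto x).comp (SchauderBasis.tendsto_proj b x)
  refine this.congr fun n => ?_
  simp [mul_comm]

theorem dual_ext {y z : StrongDual 𝕜 S} (h : ∀ i, y (b i) = z (b i)) : y = z := by
  have := hasWeakStarSum_coord b y
  simp only [h] at this
  exact this.unique (hasWeakStarSum_coord b z)

variable {b} in
theorem apply_of_hasWeakStarSum {n : ℕ → ℕ} (hn : Function.Injective n) {a : ℕ → 𝕜}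
    {y : StrongDual 𝕜 S} (h : HasWeakStarSum (fun j => a j • b.coord (n j)) y) (i : ℕ) :
    y (b (n i)) = a i := by
  refine tendsto_nhds_unique (h (b (n i)))
    (tendsto_const_nhds.congr' ((eventually_gt_atTop i).mono fun m hm => ?_))
  simp [coord_basis, hn.eq_iff, hm]

variable {b} in
theorem apply_of_hasWeakStarSum_of_notMem {n : ℕ → ℕ} {a : ℕ → 𝕜}
    {y : StrongDual 𝕜 S} (h : HasWeakStarSum (fun j => a j • b.coord (n j)) y) {i : ℕ}
    (hi : i ∉ Set.range n) : y (b i) = 0 := by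
  refine tendsto_nhds_unique (h (b i)) (tendsto_const_nhds.congr fun m => ?_)
  refine (Finset.sum_eq_zero fun j _ => ?_).symm
  rw [smul_apply, coord_basis, if_neg fun h => hi ⟨j, h⟩, smul_zero]

variable {b} in
-- Unconditionality gives the image of each functional separately; linearity is automatic because a
-- functional is determined by its values on the basis.
theorem exists_mul {C : ℝ} (hC : C ∈ unconditionalConstants b) (γ : ℕ → 𝕜)
    (hγ : ∀ i, ‖γ i‖ ≤ 1) : ∃ D : StrongDual 𝕜 S →L[𝕜] StrongDual 𝕜 S,
      ‖D‖ ≤ C ∧ ∀ i y, D y (b i) = γ i * y (b i) := by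
  have hC0 : 0 ≤ C := zero_le_one.trans hC.1
  set g : lp (fun _ : ℕ => 𝕜) ∞ := ⟨γ, memℓp_infty ⟨1, by rintro _ ⟨i, rfl⟩; exact hγ i⟩⟩ with hg
  have hg1 : ‖g‖ ≤ 1 := lp.norm_le_of_forall_le zero_le_one hγ
  choose D hD hDn using fun y => hC.2 _ y (hasWeakStarSum_coord b y) g
  have hDb : ∀ i y, D y (b i) = γ i * y (b i) := fun i y =>
    apply_of_hasWeakStarSum (n := id) Function.injective_id (hD y) i
  refine ⟨LinearMap.mkContinuous
    { toFun := D
      map_add' := fun x y => dual_ext b fun i => ?_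
      map_smul' := fun c x => dual_ext b fun i => ?_ } C fun y => ?_,
    LinearMap.mkContinuous_norm_le _ hC0 _, hDb⟩
  · simp [hDb, mul_add]
  · simp [hDb, mul_left_comm]
  · refine (hDn y).trans (mul_le_mul_of_nonneg_right ?_ (norm_nonneg y))
    exact mul_le_of_le_one_right hC0 hg1

variable {b} in
theorem IsSubsequenceMap.apply_basis {n : ℕ → ℕ} (hn : StrictMono n)
    {Φ : StrongDual 𝕜 S →L[𝕜] weakStarSpan b n} (h : IsSubsequenceMap b n Φ)
    (y : StrongDual 𝕜 S) (j : ℕ) : (Φ y : StrongDual 𝕜 S) (b (n j)) = y (b j) :=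
  apply_of_hasWeakStarSum hn.injective (h _ y (hasWeakStarSum_coord b y)) j

variable {b} in
theorem IsSubsequenceMap.apply_basis_of_notMem {n : ℕ → ℕ}
    {Φ : StrongDual 𝕜 S →L[𝕜] weakStarSpan b n} (h : IsSubsequenceMap b n Φ)
    (y : StrongDual 𝕜 S) {i : ℕ} (hi : i ∉ Set.range n) : (Φ y : StrongDual 𝕜 S) (b i) = 0 :=
  apply_of_hasWeakStarSum_of_notMem (h _ y (hasWeakStarSum_coord b y)) hi

/-- The partial sums of the weak* expansion use only the coordinate functionals `b.coord (n j)`. -/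
theorem mem_weakStarSpan {n : ℕ → ℕ} {y : StrongDual 𝕜 S}
    (hy : ∀ i ∉ Set.range n, y (b i) = 0) : y ∈ weakStarSpan b n := by
  refine mem_closure_of_tendsto (X := WeakDual 𝕜 S) (b := atTop)
    (f := fun m => StrongDual.toWeakDual (∑ j ∈ Finset.range m, y (b j) • b.coord j))
    (tendsto_iff_forall_eval_tendsto_topDualPairing.2 fun x => ?_)
    (Eventually.of_forall fun m => ?_)
  · refine (hasWeakStarSum_coord b y x).congr fun m => ?_
    change _ = (∑ j ∈ Finset.range m, y (b j) • b.coord j) x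
    simp
  · rw [map_sum]
    refine Submodule.sum_mem _ fun j _ => ?_
    rw [map_smul]
    by_cases hj : j ∈ Set.range n
    · obtain ⟨k, rfl⟩ := hj
      exact Submodule.smul_mem _ _ (Submodule.subset_span ⟨k, rfl⟩)
    · rw [hy j hj, zero_smul]; exact Submodule.zero_mem _

end WeakStarBasis

namespace WeakStarBasis

variable {𝕜 S : Type*} [RCLike 𝕜] [NormedAddCommGroup S] [NormedSpace 𝕜 S]
  {b : SchauderBasis 𝕜 S}

theorem apply_proj (m : ℕ) (y : StrongDual 𝕜 S) (i : ℕ) :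
    (y ∘L b.proj m) (b i) = if i < m then y (b i) else 0 := by
  rw [ContinuousLinearMap.comp_apply, SchauderBasis.proj_apply_basis_mem]
  split_ifs <;> simp

theorem comp_proj_eq_sum (m : ℕ) (y : StrongDual 𝕜 S) :
    y ∘L b.proj m = ∑ j ∈ Finset.range m, y (b j) • b.coord j := by
  ext x
  simp [mul_comm]

theorem eventually_lt_norm_comp_proj (y : StrongDual 𝕜 S) {r : ℝ} (hr : r < ‖y‖) :
    ∀ᶠ m in atTop, r < ‖y ∘L b.proj m‖ := by
  obtain ⟨x, hx, hrx⟩ := y.exists_lt_apply_of_lt_opNorm hr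
  have h : Tendsto (fun m => ‖(y ∘L b.proj m) x‖) atTop (𝓝 ‖y x‖) :=
    ((y.continuous.tendsto x).comp (SchauderBasis.tendsto_proj b x)).norm
  filter_upwards [h.eventually_const_lt hrx] with m hm
  exact hm.trans_le (((y ∘L b.proj m).le_opNorm x).trans
    (mul_le_of_le_one_right (norm_nonneg _) hx.le))

theorem norm_apply_basis_le (hnorm : IsNormalized b) (y : StrongDual 𝕜 S) (j : ℕ) :
    ‖y (b j)‖ ≤ ‖y‖ := by
  have := y.le_opNorm (b j)
  rwa [hnorm.1, mul_one] at this

theorem norm_sum_smul_coord_le (hnorm : IsNormalized b) (n : ℕ → ℕ) {a : ℕ → 𝕜} {r : ℝ}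
    (ha : ∀ j, ‖a j‖ ≤ r) (m : ℕ) : ‖∑ j ∈ Finset.range m, a j • b.coord (n j)‖ ≤ m * r := by
  refine (norm_sum_le_of_le (f := fun j => a j • b.coord (n j)) (n := fun _ => r) _
    fun j _ => ?_).trans (by simp)
  rw [norm_smul, hnorm.2, mul_one]
  exact ha j

/-- The isomorphisms of the dual onto its subspaces spanned by subsequences are uniformly
bounded, and so are their inverses. -/
theorem exists_isSubsequenceMap_bound [CompleteSpace S] (hnorm : IsNormalized b)
    (hsub : ∀ n : ℕ → ℕ, StrictMono n →
      ∃ Φ : StrongDual 𝕜 S ≃L[𝕜] weakStarSpan b n, IsSubsequenceMap b n Φ) :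
    ∃ D, ∀ n : ℕ → ℕ, StrictMono n → ∀ Φ : StrongDual 𝕜 S ≃L[𝕜] weakStarSpan b n,
      IsSubsequenceMap b n Φ → ∀ y, ‖Φ y‖ ≤ D * ‖y‖ ∧ ‖y‖ ≤ D * ‖Φ y‖ := by
  have key : ∀ n : ℕ → ℕ, StrictMono n → ∃ (U : StrongDual 𝕜 S →L[𝕜] StrongDual 𝕜 S) (c : ℝ),
      0 < c ∧ (∀ y j, U y (b (n j)) = y (b j)) ∧ (∀ i ∉ Set.range n, ∀ y, U y (b i) = 0) ∧
      ∀ y, ‖U y‖ ≤ c * ‖y‖ ∧ ‖y‖ ≤ c * ‖U y‖ := fun n hn => by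
    obtain ⟨Φ, hΦ⟩ := hsub n hn
    obtain ⟨U, hU⟩ := exists_op_of_equiv Φ
    obtain ⟨c, hc, hΦc⟩ := exists_bounds_of_equiv Φ
    refine ⟨U, c, hc, fun y j => ?_, fun i hi y => ?_, fun y => ?_⟩
    · rw [hU]; exact hΦ.apply_basis hn y j
    · rw [hU]; exact hΦ.apply_basis_of_notMem y hi
    · rw [hU]; exact hΦc y
  choose! U c hc hU hU0 hUc using key
  have hUeq : ∀ n, StrictMono n → ∀ y z : StrongDual 𝕜 S, (∀ j, z (b (n j)) = y (b j)) →
      (∀ i ∉ Set.range n, z (b i) = 0) → U n y = z := fun n hn y z h1 h2 =>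
    dual_ext b fun i => by
      by_cases hi : i ∈ Set.range n
      · obtain ⟨j, rfl⟩ := hi
        rw [hU n hn, h1]
      · rw [hU0 n hn i hi, h2 i hi]
  have hUproj : ∀ n, StrictMono n → ∀ m y, U n (y ∘L b.proj m) = U n y ∘L b.proj (n m) :=
    fun n hn m y => hUeq n hn _ _ (fun j => by
      rw [apply_proj, apply_proj, hU n hn]
      simp only [hn.lt_iff_lt]) fun i hi => by
      rw [apply_proj, hU0 n hn i hi, ite_self]
  have hUcoord : ∀ n, StrictMono n → ∀ j, U n (b.coord j) = b.coord (n j) := fun n hn j =>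
    hUeq n hn _ _ (fun i => by simp [coord_basis, hn.injective.eq_iff]) fun i hi => by
      rw [coord_basis, if_neg fun h => hi ⟨j, h⟩]
  have hUsum : ∀ n, StrictMono n → ∀ m y, U n (y ∘L b.proj m) =
      ∑ j ∈ Finset.range m, y (b j) • b.coord (n j) := fun n hn m y => by
    rw [comp_proj_eq_sum, map_sum]
    exact Finset.sum_congr rfl fun j _ => by rw [map_smul, hUcoord n hn]
  -- A shifted subsequence map factors through the shift by `d`, so the cost of shifting depends on
  -- `d` but not on `n`.
  have hUshift : ∀ d, ∀ n, StrictMono n → ∀ y,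
      U (fun j => n j + d) y = U (fun j => j + d) (U n y) := fun d n hn y => by
    have hd : StrictMono fun j : ℕ => j + d := strictMono_id.add_const d
    refine hUeq _ (hn.add_const d) _ _ (fun j => ?_) fun i hi => ?_
    · rw [hU _ hd (U n y) (n j), hU n hn]
    · by_cases h : i ∈ Set.range fun j : ℕ => j + d
      · obtain ⟨k, rfl⟩ := h
        rw [hU _ hd (U n y) k]
        refine hU0 n hn k (fun ⟨j, hj⟩ => hi ⟨j, ?_⟩) y
        simp only [hj]
      · exact hU0 _ hd i h _
  obtain ⟨K, hK⟩ := SchauderBasis.exists_norm_proj_le b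
  have hproj : ∀ (y : StrongDual 𝕜 S) m m',
      ‖y ∘L b.proj m' - y ∘L b.proj m‖ ≤ (K + K) * ‖y‖ := fun y m m' => by
    have h : ∀ k, ‖y ∘L b.proj k‖ ≤ K * ‖y‖ := fun k =>
      (y.opNorm_comp_le _).trans (by rw [mul_comm]; gcongr; exact hK k)
    refine (norm_sub_le_of_le (h m') (h m)).trans (le_of_eq (by ring))
  have hloc : ∀ n, StrictMono n → ∀ n', StrictMono n' → ∀ m m', m ≤ m' →
      (∀ j, m ≤ j → j < m' → n j = n' j) → ∀ y : StrongDual 𝕜 S,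
      U n (y ∘L b.proj m' - y ∘L b.proj m) = U n' (y ∘L b.proj m' - y ∘L b.proj m) :=
    fun n hn n' hn' m m' hm h y => by
      rw [map_sub, map_sub, hUsum n hn, hUsum n hn, hUsum n' hn', hUsum n' hn',
        ← Finset.sum_Ico_eq_sub _ hm, ← Finset.sum_Ico_eq_sub _ hm]
      exact Finset.sum_congr rfl fun j hj => by
        rw [h j (Finset.mem_Ico.1 hj).1 (Finset.mem_Ico.1 hj).2]
  -- The hump principle is used twice, with the roles of the identity and `U` exchanged, for the
  -- maps and for their inverses.
  obtain ⟨D₁, hD₁⟩ := exists_uniform_bound (fun m y => y ∘L b.proj m)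
    (fun _ => ContinuousLinearMap.id 𝕜 (StrongDual 𝕜 S)) U (K := K + K)
    (fun n _ m m' y => hproj y m m')
    (fun n hn m y => by
      rw [hUsum n hn]
      exact norm_sum_smul_coord_le hnorm n (norm_apply_basis_le hnorm y) m)
    (fun n hn y r hr => by
      simp only [hUproj n hn]
      exact hn.tendsto_atTop.eventually (eventually_lt_norm_comp_proj (U n y) hr))
    (fun n hn n' hn' m m' hm h y => ⟨rfl, hloc n hn n' hn' m m' hm h y⟩)
    (fun n hn => ⟨c n, fun y => (hUc n hn y).1⟩)
    (fun d => by
      have hd : StrictMono fun j : ℕ => j + d := strictMono_id.add_const d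
      refine ⟨max 1 (c fun j => j + d), by positivity, fun n hn y => ⟨?_, ?_⟩⟩
      · exact le_mul_of_one_le_left (norm_nonneg _) (le_max_left _ _)
      · rw [hUshift d n hn]
        exact ((hUc _ hd (U n y)).2).trans (by gcongr; exact le_max_right _ _))
  obtain ⟨D₂, hD₂⟩ := exists_uniform_bound (fun m y => y ∘L b.proj m)
    U (fun _ => ContinuousLinearMap.id 𝕜 (StrongDual 𝕜 S)) (K := K + K)
    (fun n hn m m' y => by
      rw [map_sub, hUproj n hn, hUproj n hn]
      exact hproj _ _ _)
    (fun n hn m y => by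
      rw [ContinuousLinearMap.id_apply, comp_proj_eq_sum]
      refine norm_sum_smul_coord_le hnorm id (fun j => ?_) m
      rw [← hU n hn]
      exact norm_apply_basis_le hnorm _ _)
    (fun n _ y r hr => eventually_lt_norm_comp_proj y hr)
    (fun n hn n' hn' m m' hm h y => ⟨hloc n hn n' hn' m m' hm h y, rfl⟩)
    (fun n hn => ⟨c n, fun y => (hUc n hn y).2⟩)
    (fun d => by
      have hd : StrictMono fun j : ℕ => j + d := strictMono_id.add_const d
      refine ⟨max 1 (c fun j => j + d), by positivity, fun n hn y => ⟨?_, ?_⟩⟩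
      · rw [hUshift d n hn]
        exact ((hUc _ hd (U n y)).1).trans (by gcongr; exact le_max_right _ _)
      · exact le_mul_of_one_le_left (norm_nonneg _) (le_max_left _ _))
  refine ⟨max D₁ D₂, fun n hn Φ hΦ y => ?_⟩
  have hΦU : U n y = Φ y := hUeq n hn _ _ (hΦ.apply_basis hn y)
    fun i hi => hΦ.apply_basis_of_notMem y hi
  have h1 := hD₁ n hn y
  have h2 := hD₂ n hn y
  rw [hΦU] at h1 h2
  exact ⟨h1.trans (mul_le_mul_of_nonneg_right (le_max_left _ _) (norm_nonneg y)),
    h2.trans (mul_le_mul_of_nonneg_right (le_max_right _ _) (norm_nonneg _))⟩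

end WeakStarBasis

/-! ### The constants and the subsymmetric system of the dual. -/

namespace WeakStarBasis

variable {𝕜 S : Type*} [RCLike 𝕜] [NormedAddCommGroup S] [NormedSpace 𝕜 S]
  {b : SchauderBasis 𝕜 S}

theorem one_le_Ku (h : IsUnconditional b) : 1 ≤ Ku b := le_csInf h fun _ hC => hC.1

/-- The uniform bound makes the set under the real supremum bounded above; otherwise `Ks` would be a
default value. -/
theorem le_Ks [CompleteSpace S] (hnorm : IsNormalized b) (hsub : IsSubsymmetric b) {n : ℕ → ℕ}
    (hn : StrictMono n) {Φ : StrongDual 𝕜 S ≃L[𝕜] weakStarSpan b n} (hΦ : IsSubsequenceMap b n Φ) :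
    ∀ r ∈ isoNorms Φ, r ≤ Ks b := fun r hr => by
  obtain ⟨D, hD⟩ := exists_isSubsequenceMap_bound hnorm hsub.2
  refine le_csSup ⟨max D 0, ?_⟩ ⟨n, hn, Φ, hΦ, hr⟩
  rintro r ⟨n, hn, Φ, hΦ, hr⟩
  exact isoNorms_le_of_bounds Φ (hD n hn Φ hΦ) r hr

theorem one_le_Ks [CompleteSpace S] (hnorm : IsNormalized b) (hsub : IsSubsymmetric b) :
    1 ≤ Ks b := by
  obtain ⟨Φ, hΦ⟩ := hsub.2 id strictMono_id
  have h := (bounds_of_isoNorms_le Φ (le_Ks hnorm hsub strictMono_id hΦ) (b.coord 0)).1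
  have hid : (Φ (b.coord 0) : StrongDual 𝕜 S) = b.coord 0 :=
    dual_ext b fun i => hΦ.apply_basis strictMono_id _ i
  rwa [Submodule.coe_norm, hid, hnorm.2, mul_one] at h

theorem coordProj_eq {A : Set ℕ} {y z : StrongDual 𝕜 S}
    (h : ∀ i, z (b i) = A.indicator (1 : ℕ → 𝕜) i * y (b i)) : coordProj b A y = z := by
  classical
  refine HasWeakStarSum.weakStarSum_eq fun x => ?_
  refine (hasWeakStarSum_coord b z x).congr fun n => Finset.sum_congr rfl fun j _ => ?_
  by_cases hj : j ∈ A <;> simp [h, hj]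

/-- The coordinate functionals of the basis form a subsymmetric system in the dual. -/
theorem exists_subsymmetricSystem [CompleteSpace S] (hnorm : IsNormalized b)
    (hsub : IsSubsymmetric b) (hC : ConditionC b) {C : ℝ} (hCu : C ∈ unconditionalConstants b) :
    ∃ B : SubsymmetricSystem 𝕜 (StrongDual 𝕜 S), B.K = C ∧ B.L = Ks b := by
  choose! mul hmul hmulb using fun γ hγ => exists_mul hCu γ hγ
  have hind := SubsymmetricSystem.norm_indicator_le (𝕜 := 𝕜)
  refine ⟨{
    coord := fun i => ContinuousLinearMap.apply 𝕜 𝕜 (b i)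
    vec := b.coord
    K := C
    L := Ks b
    mul := mul
    norm_coord_le := fun i => ContinuousLinearMap.opNorm_le_bound _ zero_le_one fun y => by
      rw [one_mul]; exact norm_apply_basis_le hnorm y i
    norm_vec_le := fun i => (hnorm.2 i).le
    coord_vec := fun i j => by
      rw [ContinuousLinearMap.apply_apply, coord_basis]; simp only [eq_comm]
    ext := fun y z h => dual_ext b h
    norm_mul_le := hmul
    coord_mul := hmulb
    exists_spread := fun n hn => ?_
    exists_small := fun Λ hΛ θ hθ => ?_ }, rfl, rfl⟩
  · obtain ⟨Φ, hΦ⟩ := hsub.2 n hn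
    have hr := hind (Set.range n)
    obtain ⟨U, T, hU, hT, hUΦ, hTΦ⟩ := exists_ops_of_isoNorms_le Φ (le_Ks hnorm hsub hn hΦ)
      (D := mul ((Set.range n).indicator 1)) (fun y => mem_weakStarSpan b fun i hi => by
        rw [hmulb _ hr, Set.indicator_of_notMem hi, zero_mul]) (hmul _ hr)
    refine ⟨U, T, hU, hT, fun j y => ?_, fun i hi y => ?_, fun j y => ?_⟩
    · rw [ContinuousLinearMap.apply_apply, hUΦ]; exact hΦ.apply_basis hn y j
    · rw [ContinuousLinearMap.apply_apply, hUΦ]; exact hΦ.apply_basis_of_notMem y hi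
    · have h1 : (Φ (T y) : StrongDual 𝕜 S) (b (n j)) = T y (b j) := hΦ.apply_basis hn _ j
      rw [ContinuousLinearMap.apply_apply, ContinuousLinearMap.apply_apply, ← h1, hTΦ, hmulb _ hr,
        Set.indicator_of_mem (Set.mem_range_self j), Pi.one_apply, one_mul]
  · obtain ⟨A, hA, hdis, h⟩ := hC Λ hΛ θ hθ
    refine ⟨A, hA, hdis, fun x hx => ?_⟩
    obtain ⟨a, ha, z, hz, hzθ⟩ := h x hx
    have ha1 : HasSum (fun j => ‖a j‖) 1 := by
      simpa [ha] using lp.hasSum_norm (p := 1) (by simp) a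
    refine ⟨a, ha1, z, ?_, hzθ⟩
    have hle : ∀ j, ‖a j • mul ((A j).indicator 1) (x j)‖ ≤ ‖a j‖ * C := fun j => by
      rw [norm_smul]
      refine mul_le_mul_of_nonneg_left (((mul ((A j).indicator 1)).le_of_opNorm_le
        (hmul _ (hind (A j))) _).trans ?_) (norm_nonneg _)
      exact mul_le_of_le_one_right (zero_le_one.trans hCu.1) (hx j)
    have hs : Summable fun j => a j • mul ((A j).indicator 1) (x j) :=
      Summable.of_norm_bounded (ha1.mul_right C).summable hle
    have hproj : ∀ j, coordProj b (A j) (x j) = mul ((A j).indicator 1) (x j) := fun j =>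
      coordProj_eq fun i => hmulb _ (hind (A j)) i (x j)
    simp only [hproj] at hz
    -- For an `ℓ¹` sequence of coefficients and uniformly bounded terms the series converges in
    -- norm, so its norm sum and the weak* sum from condition (C) coincide.
    have hz' : HasWeakStarSum (fun j => a j • mul ((A j).indicator 1) (x j))
        (∑' j, a j • mul ((A j).indicator 1) (x j)) := fun y => by
      have := ((ContinuousLinearMap.apply 𝕜 𝕜 y).hasSum hs.hasSum).tendsto_sum_nat
      exact this
    rw [hz.unique hz']
    exact hs.hasSum

end WeakStarBasis

theorem theorem2 {𝕜 S : Type*} [RCLike 𝕜] [NormedAddCommGroup S] [NormedSpace 𝕜 S]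
    [CompleteSpace S] (b : SchauderBasis 𝕜 S)
    (hnorm : WeakStarBasis.IsNormalized b)
    (hsub : WeakStarBasis.IsSubsymmetric b)
    (hC : WeakStarBasis.ConditionC b)
    (p : ℝ≥0∞) [Fact (1 ≤ p)] :
    (∀ T : lp (fun _ : ℕ => StrongDual 𝕜 S) p →L[𝕜] lp (fun _ : ℕ => StrongDual 𝕜 S) p,
      ∃ H : lp (fun _ : ℕ => StrongDual 𝕜 S) p →L[𝕜] lp (fun _ : ℕ => StrongDual 𝕜 S) p,
        (H = T ∨ H = ContinuousLinearMap.id 𝕜 (lp (fun _ : ℕ => StrongDual 𝕜 S) p) - T) ∧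
        ∃ M N : lp (fun _ : ℕ => StrongDual 𝕜 S) p →L[𝕜] lp (fun _ : ℕ => StrongDual 𝕜 S) p,
          N ∘L H ∘L M = ContinuousLinearMap.id 𝕜 (lp (fun _ : ℕ => StrongDual 𝕜 S) p) ∧
          ‖M‖ * ‖N‖ ≤ 48 * WeakStarBasis.Ku b ^ 7 * WeakStarBasis.Ks b ^ 4) ∧
    IsPrimary 𝕜 (lp (fun _ : ℕ => StrongDual 𝕜 S) p) := by
  have hu := WeakStarBasis.one_le_Ku hsub.1
  have hs := WeakStarBasis.one_le_Ks hnorm hsub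
  -- The infimum `Ku` need not be known to be attained. A constant below `2 * Ku` gives `4 (2 K_u)²
  -- K_s² = 16 K_u² K_s²`, well within the claimed bound since both constants are at least 1.
  obtain ⟨C, hCu, hC2⟩ := exists_lt_of_csInf_lt hsub.1
    (show sInf (WeakStarBasis.unconditionalConstants b) < 2 * WeakStarBasis.Ku b by
      change WeakStarBasis.Ku b < _; linarith)
  obtain ⟨B, hK, hL⟩ := WeakStarBasis.exists_subsymmetricSystem hnorm hsub hC hCu
  refine ⟨fun T => ?_, B.isPrimary_lp p⟩
  obtain ⟨H, hH, M, N, h, hMN⟩ := B.exists_factorization T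
  refine ⟨H, hH, M, N, h, hMN.trans ?_⟩
  rw [hK, hL]
  set u := WeakStarBasis.Ku b
  set s := WeakStarBasis.Ks b
  have hC0 : 0 ≤ C := zero_le_one.trans hCu.1
  calc 4 * C ^ 2 * s ^ 2 ≤ 4 * (2 * u) ^ 2 * s ^ 2 := by gcongr
    _ = 16 * u ^ 2 * s ^ 2 := by ring
    _ ≤ 48 * u ^ 7 * s ^ 4 := by
      have h1 : u ^ 2 ≤ u ^ 7 := pow_le_pow_right₀ hu (by norm_num)
      have h2 : s ^ 2 ≤ s ^ 4 := pow_le_pow_right₀ hs (by norm_num)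
      gcongr
      norm_num
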